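/- Let $z,z'\in\mathbb C$ satisfy one of the following two conditions: either $z'=\bar z$ and $z\notin\mathbb Z$; or $z,z'$ are real and $m<z,z'<m+1$ for some $m\in\mathbb Z$. Put $$a=\frac{z+z'}2,\qquad \mu=\frac{z-z'}2,\qquad t=zz',\qquad \sigma=\sqrt{\sin(\pi z)\sin(\pi z')}>0 .$$ For $\kappa,\mu\in\mathbb C$ let $W_{\kappa,\mu}$ denote the Whittaker function on $\mathbb R_+=(0,\infty)$, that is, the only solution of $$y''-\Bigl(\frac14-\frac{\kappa}{x}+\frac{\mu^2-\frac14}{x^2}\Bigr)y=0$$ on $\mathbb R_+$ with $y(x)\sim x^{\kappa}e^{-x/2}$ as $x\to+\infty$, and put $$A_\pm(x)=x^{-1/2}\,W_{\pm a+\frac12,\mu}(x),\qquad B_\pm(x)=x^{-1/2}\,W_{\pm a-\frac12,\mu}(x)\qquad(x>0).$$ The matrix Whittaker kernel $\begin{bmatrix}K_{++}&K_{+-}\\K_{-+}&K_{--}\end{bmatrix}$ on $\mathbb R_+$ has the blocks $$K_{++}(x,y)=\frac1{\Gamma(z)\Gamma(z')}\,\frac{A_+(x)B_+(y)-B_+(x)A_+(y)}{x-y},\qquad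 K_{+-}(x,y)=\frac\sigma\pi\,\frac{A_+(x)A_-(y)+tB_+(x)B_-(y)}{x+y},$$ $$K_{-+}(x,y)=-\frac\sigma\pi\,\frac{A_+(y)A_-(x)+tB_+(y)B_-(x)}{x+y},\qquad K_{--}(x,y)=\frac1{\Gamma(-z)\Gamma(-z')}\,\frac{A_-(x)B_-(y)-B_-(x)A_-(y)}{x-y}.$$ **Theorem.** Assume $|a|<\frac12$. Then the matrix Whittaker kernel is the kernel of a bounded operator $K$ on $L^2(\mathbb R_+,dx)\oplus L^2(\mathbb R_+,dx)$, the matrix kernel $$\begin{bmatrix}0&\dfrac\sigma\pi\Bigl(\dfrac xy\Bigr)^{a}\dfrac{e^{-(x+y)/2}}{x+y}\\[2mm]-\dfrac\sigma\pi\Bigl(\dfrac yx\Bigr)^{a}\dfrac{e^{-(x+y)/2}}{x+y}&0\end{bmatrix}$$ is the kernel of a bounded operator $L$ on the same space, $1+L$ has a bounded inverse, and $$K=L(1+L)^{-1}.$$ -/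

import Mathlib

open Filter Topology MeasureTheory Asymptotics

noncomputable section

namespace MatrixWhittaker

/-- The standing assumption on the two parameters (the second one, written `w` here, is usually
denoted by a primed `z`): either `w` is the complex conjugate of `z` and `z` is not an integer, or
`z` and `w` are both real and lie strictly between two consecutive integers `m` and `m + 1`. -/
def Admissible (z w : ℂ) : Prop :=
  (w = starRingEnd ℂ z ∧ ∀ m : ℤ, z ≠ (m : ℂ)) ∨
  (z.im = 0 ∧ w.im = 0 ∧
    ∃ m : ℤ, (m : ℝ) < z.re ∧ z.re < m + 1 ∧ (m : ℝ) < w.re ∧ w.re < m + 1)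

/-- `a = (z + w) / 2`. For admissible parameters `z + w` is real, so taking the real part only
changes the type. -/
def aParam (z w : ℂ) : ℝ := ((z + w) / 2).re

/-- `μ = (z - w) / 2`, which is real or purely imaginary for admissible parameters. -/
def muParam (z w : ℂ) : ℂ := (z - w) / 2

/-- `σ = √(sin (π z) sin (π w))`. For admissible parameters the product is a positive real number,
so taking the real part only changes the type. -/
def sigmaParam (z w : ℂ) : ℝ :=
  √((Complex.sin (Real.pi * z) * Complex.sin (Real.pi * w)).re)

/-- `f`, restricted to the positive half-line, solves the Whittaker equation
`y'' - (1/4 - κ/x + (μ² - 1/4)/x²) y = 0` and satisfies `y ∼ x ^ κ * exp (-x/2)` as `x → +∞`. -/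
def IsWhittakerW (κ μ : ℂ) (f : ℝ → ℂ) : Prop :=
  (∃ g : ℝ → ℂ, ∀ x : ℝ, 0 < x →
    HasDerivAt f (g x) x ∧
    HasDerivAt g ((1 / 4 - κ / (x : ℂ) + (μ ^ 2 - 1 / 4) / (x : ℂ) ^ 2) * f x) x) ∧
  f ~[atTop] fun x : ℝ => (x : ℂ) ^ κ * Complex.exp (-(x : ℂ) / 2)

/-- The Whittaker function `W_{κ,μ}` on the positive half-line: the only solution there of the
Whittaker equation with `W_{κ,μ}(x) ∼ x ^ κ * exp (-x/2)` as `x → +∞`. Only its values at positive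
`x` are meaningful. -/
def whittakerW (κ μ : ℂ) : ℝ → ℂ := Classical.epsilon (IsWhittakerW κ μ)

/-- `A₊(x) = x ^ (-1/2) * W_{a + 1/2, μ}(x)`. -/
def APlus (z w : ℂ) (x : ℝ) : ℂ :=
  whittakerW (aParam z w + 1 / 2) (muParam z w) x / (√x : ℝ)

/-- `B₊(x) = x ^ (-1/2) * W_{a - 1/2, μ}(x)`. -/
def BPlus (z w : ℂ) (x : ℝ) : ℂ :=
  whittakerW (aParam z w - 1 / 2) (muParam z w) x / (√x : ℝ)

/-- `A₋(x) = x ^ (-1/2) * W_{-a + 1/2, μ}(x)`. -/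
def AMinus (z w : ℂ) (x : ℝ) : ℂ :=
  whittakerW (-aParam z w + 1 / 2) (muParam z w) x / (√x : ℝ)

/-- `B₋(x) = x ^ (-1/2) * W_{-a - 1/2, μ}(x)`. -/
def BMinus (z w : ℂ) (x : ℝ) : ℂ :=
  whittakerW (-aParam z w - 1 / 2) (muParam z w) x / (√x : ℝ)

/-- The `++` block of the matrix Whittaker kernel (off the diagonal `x = y`, a null set). -/
def KPlusPlus (z w : ℂ) (x y : ℝ) : ℂ :=
  1 / (Complex.Gamma z * Complex.Gamma w) *
    ((APlus z w x * BPlus z w y - BPlus z w x * APlus z w y) / ((x : ℂ) - y))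

/-- The `+-` block of the matrix Whittaker kernel. -/
def KPlusMinus (z w : ℂ) (x y : ℝ) : ℂ :=
  (sigmaParam z w : ℂ) / Real.pi *
    ((APlus z w x * AMinus z w y + z * w * BPlus z w x * BMinus z w y) / ((x : ℂ) + y))

/-- The `-+` block of the matrix Whittaker kernel. -/
def KMinusPlus (z w : ℂ) (x y : ℝ) : ℂ :=
  -((sigmaParam z w : ℂ) / Real.pi) *
    ((APlus z w y * AMinus z w x + z * w * BPlus z w y * BMinus z w x) / ((x : ℂ) + y))

/-- The `--` block of the matrix Whittaker kernel (off the diagonal `x = y`, a null set). -/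
def KMinusMinus (z w : ℂ) (x y : ℝ) : ℂ :=
  1 / (Complex.Gamma (-z) * Complex.Gamma (-w)) *
    ((AMinus z w x * BMinus z w y - BMinus z w x * AMinus z w y) / ((x : ℂ) - y))

/-- The matrix Whittaker kernel; the index `0` stands for `+` and `1` for `-`. -/
def whittakerKernel (z w : ℂ) : Matrix (Fin 2) (Fin 2) (ℝ → ℝ → ℂ) :=
  !![KPlusPlus z w, KPlusMinus z w; KMinusPlus z w, KMinusMinus z w]

/-- The matrix kernel with zero diagonal blocks and off-diagonal blocks
`(σ/π) (x/y)^a exp (-(x+y)/2) / (x+y)` and `-(σ/π) (y/x)^a exp (-(x+y)/2) / (x+y)`. -/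
def LKernel (z w : ℂ) : Matrix (Fin 2) (Fin 2) (ℝ → ℝ → ℂ) :=
  !![fun _ _ => 0,
     fun x y => ((sigmaParam z w / Real.pi * (x / y) ^ aParam z w *
       (Real.exp (-(x + y) / 2) / (x + y)) : ℝ) : ℂ);
     fun x y => ((-(sigmaParam z w / Real.pi) * (y / x) ^ aParam z w *
       (Real.exp (-(x + y) / 2) / (x + y)) : ℝ) : ℂ),
     fun _ _ => 0]

/-- Lebesgue measure on the positive half-line. -/
abbrev halfLine : Measure ℝ := volume.restrict (Set.Ioi 0)

/-- The Hilbert space `L²(ℝ₊, dx) ⊕ L²(ℝ₊, dx)`. -/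
abbrev TwoL2 : Type := PiLp 2 (fun _ : Fin 2 => Lp ℂ 2 halfLine)

/-- `T` is the integral operator given by the matrix kernel `k`: for every `f` and almost every
`x`, the integrals `∫ k i j x y * f j y dy` converge absolutely and add up to `(T f) i x`.
A bounded operator with a given kernel is unique. -/
def HasMatrixKernel (T : TwoL2 →L[ℂ] TwoL2) (k : Matrix (Fin 2) (Fin 2) (ℝ → ℝ → ℂ)) : Prop :=
  ∀ (f : TwoL2) (i : Fin 2), ∀ᵐ x ∂halfLine,
    (∀ j : Fin 2, Integrable (fun y => k i j x y * f j y) halfLine) ∧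
    T f i x = ∑ j : Fin 2, ∫ y, k i j x y * f j y ∂halfLine

end MatrixWhittaker

end

noncomputable section

namespace MatrixWhittaker

open scoped ENNReal NNReal

/-! Let k(x,y) = (σ/π)(x/y)^a e^{-(x+y)/2}/(x+y), so that L has off-diagonal blocks k and -kᵀ. Up to
exponentials, k is homogeneous of degree -1, and |a| < 1/2 is what Schur's test with weight x^{-1/2}
needs (`isSchurKernel_crossKernel`). Since k is real, L is skew-adjoint, so 1 + L is invertible. K
is then defined as L(1+L)⁻¹, which makes it bounded, and only its kernel has to be identified.

The identity K(1+L) = L says, for the first row, K₊₊(x,y) = ∫ K₊₋(x,u) k(y,u) du and K₊₋(x,y) + ∫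
K₊₊(x,u) k(u,y) du = k(x,y). The second row is the same statement with (z,w,a) replaced by
(-z,-w,-a).

Write A₊ = x^a e^{-x/2} p and B₊ = x^a e^{-x/2} q. Then x p' = t q, x q' = (x-2a) q - p, with p → 1
and x q → 1 at infinity; explicit solutions come from Tricomi's integral
(`CoreParams.whittakerPair`). Two integral identities carry the proof.

(1) `WhittakerPair.eq_stieltjes`: the Stieltjes transforms of A₋ and B₋ times x^{-a} e^{-x/2} are
multiples of q and (1-p)/t. The transform commutes with the Euler operator, so it maps one system to
the other, and uniqueness of the decaying solution does the rest. The multiple is a total mass,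
computed as Γ(1-z)Γ(1-w).

(2) `WhittakerPair.integral_wronskian_div_sub`: the integral of the Christoffel–Darboux quotient
against x^a e^{-x/2} is again a multiple of (1-p)/t, by a scaling argument and Fubini.

Partial fractions reduce the two row equations to (1), and to (1) and (2) respectively
(`CoreParams.diagBlock_eq_integral`, `CoreParams.crossBlock_add_integral`); the constants match by
the reflection formula for Γ. Finally, if f = (1+L)g and the row r_x of K satisfies r_x(1+L) = ℓ_x,
then (Kf)(x) = ℓ_x·g = r_x·f (`IsSchurKernel.pairing_eq`). -/

/-! ### Uniqueness of the decaying solution of the Whittaker equation. -/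

/-- A planar linear system `f' = g`, `g' = c f` with continuous coefficient has unique solutions,
integrated backwards from a common value. -/
theorem eqOn_of_linear_ode {c : ℝ → ℂ} {f₁ g₁ f₂ g₂ : ℝ → ℂ} {α β : ℝ} (hαβ : α ≤ β)
    (hc : ContinuousOn c (Set.Icc α β))
    (hf₁ : ∀ x ∈ Set.Icc α β, HasDerivAt f₁ (g₁ x) x)
    (hg₁ : ∀ x ∈ Set.Icc α β, HasDerivAt g₁ (c x * f₁ x) x)
    (hf₂ : ∀ x ∈ Set.Icc α β, HasDerivAt f₂ (g₂ x) x)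
    (hg₂ : ∀ x ∈ Set.Icc α β, HasDerivAt g₂ (c x * f₂ x) x)
    (hf : f₁ β = f₂ β) (hg : g₁ β = g₂ β) : f₁ α = f₂ α := by
  obtain ⟨C, hC⟩ := isCompact_Icc.exists_bound_of_continuousOn hc
  let v : ℝ → ℂ × ℂ → ℂ × ℂ := fun t u => (u.2, c t * u.1)
  have hv : ∀ t ∈ Set.Ioc α β, LipschitzOnWith (max 1 C.toNNReal) (v t) Set.univ := by
    intro t ht
    have hCt := hC t (Set.Ioc_subset_Icc_self ht)
    have hC0 : 0 ≤ C := (norm_nonneg _).trans hCt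
    refine (LipschitzWith.of_dist_le_mul fun u w => ?_).lipschitzOnWith
    have hK : ((max 1 C.toNNReal : NNReal) : ℝ) = max 1 C := by
      push_cast
      rw [Real.coe_toNNReal _ hC0]
    rw [hK, Prod.dist_eq, Prod.dist_eq]
    refine max_le ?_ ?_
    · calc dist u.2 w.2 ≤ max (dist u.1 w.1) (dist u.2 w.2) := le_max_right _ _
        _ = 1 * max (dist u.1 w.1) (dist u.2 w.2) := (one_mul _).symm
        _ ≤ _ := by gcongr; exact le_max_left _ _
    · calc dist (c t * u.1) (c t * w.1) = ‖c t‖ * dist u.1 w.1 := by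
            rw [dist_eq_norm, ← mul_sub, norm_mul, dist_eq_norm]
        _ ≤ max 1 C * max (dist u.1 w.1) (dist u.2 w.2) := by
            gcongr
            · exact hCt.trans (le_max_right _ _)
            · exact le_max_left _ _
  have key := ODE_solution_unique_of_mem_Icc_left (v := v) (s := fun _ => Set.univ)
    (f := fun x => (f₁ x, g₁ x)) (g := fun x => (f₂ x, g₂ x)) (a := α) (b := β) hv
    (fun x hx => ((hf₁ x hx).prodMk (hg₁ x hx)).continuousAt.continuousWithinAt)
    (fun x hx => ((hf₁ x (Set.Ioc_subset_Icc_self hx)).prodMk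
      (hg₁ x (Set.Ioc_subset_Icc_self hx))).hasDerivWithinAt)
    (fun _ _ => Set.mem_univ _)
    (fun x hx => ((hf₂ x hx).prodMk (hg₂ x hx)).continuousAt.continuousWithinAt)
    (fun x hx => ((hf₂ x (Set.Ioc_subset_Icc_self hx)).prodMk
      (hg₂ x (Set.Ioc_subset_Icc_self hx))).hasDerivWithinAt)
    (fun _ _ => Set.mem_univ _) (by simp [hf, hg])
  exact congrArg Prod.fst (key (Set.left_mem_Icc.2 hαβ))

theorem whittaker_weight_eq (κ : ℝ) {x : ℝ} (hx : 0 < x) :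
    (x : ℂ) ^ (κ : ℂ) * Complex.exp (-(x : ℂ) / 2) = ((x ^ κ * Real.exp (-x / 2) : ℝ) : ℂ) := by
  rw [← Complex.ofReal_cpow hx.le]
  push_cast
  rfl

theorem tendsto_rpow_mul_exp_neg_div_two (κ : ℝ) :
    Tendsto (fun x : ℝ => x ^ κ * Real.exp (-x / 2)) atTop (𝓝 0) := by
  refine (tendsto_rpow_mul_exp_neg_mul_atTop_nhds_zero κ (1 / 2) (by norm_num)).congr fun x => ?_
  congr 2
  ring

theorem IsWhittakerW.tendsto_div_weight {κ : ℝ} {μ : ℂ} {f : ℝ → ℂ} (h : IsWhittakerW κ μ f) :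
    Tendsto (fun x => f x / ((x ^ κ * Real.exp (-x / 2) : ℝ) : ℂ)) atTop (𝓝 1) := by
  have h0 : ∀ᶠ x : ℝ in atTop, (x : ℂ) ^ (κ : ℂ) * Complex.exp (-(x : ℂ) / 2) ≠ 0 := by
    filter_upwards [eventually_gt_atTop 0] with x hx
    rw [whittaker_weight_eq κ hx]
    exact_mod_cast (by positivity : x ^ κ * Real.exp (-x / 2) ≠ 0)
  refine ((isEquivalent_iff_tendsto_one h0).1 h.2).congr' ?_
  filter_upwards [eventually_gt_atTop 0] with x hx
  simp only [Pi.div_apply]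
  rw [whittaker_weight_eq κ hx]

/-- Reduction of order: the Wronskian D is constant and (f₂/f₁)' = D/f₁². Near infinity f₁ is close
to a positive weight tending to 0, so Re(1/f₁²) ≥ 1 there; as f₂/f₁ converges, D must vanish. -/
theorem IsWhittakerW.eqOn {κ : ℝ} {μ : ℂ} {f₁ f₂ : ℝ → ℂ} (h₁ : IsWhittakerW κ μ f₁)
    (h₂ : IsWhittakerW κ μ f₂) : Set.EqOn f₁ f₂ (Set.Ioi 0) := by
  have l₁ := h₁.tendsto_div_weight
  have l₂ := h₂.tendsto_div_weight
  obtain ⟨⟨g₁, hg₁⟩, -⟩ := h₁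
  obtain ⟨⟨g₂, hg₂⟩, -⟩ := h₂
  set m : ℝ → ℝ := fun x => x ^ κ * Real.exp (-x / 2) with hm
  have mpos : ∀ x : ℝ, 0 < x → 0 < m x := fun x hx => by positivity
  have hWr : ∀ x : ℝ, 0 < x → HasDerivAt (fun y => f₁ y * g₂ y - f₂ y * g₁ y) 0 x := by
    intro x hx
    have := ((hg₁ x hx).1.mul (hg₂ x hx).2).sub ((hg₂ x hx).1.mul (hg₁ x hx).2)
    exact this.congr_deriv (by ring)
  obtain ⟨D, hD⟩ : ∃ D, ∀ x : ℝ, 0 < x → f₁ x * g₂ x - f₂ x * g₁ x = D := by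
    refine ⟨_, fun x hx => isOpen_Ioi.is_const_of_deriv_eq_zero isPreconnected_Ioi
      (fun y hy => (hWr y hy).differentiableAt.differentiableWithinAt)
      (fun y hy => (hWr y hy).deriv) hx (Set.mem_Ioi.2 one_pos)⟩
  have hr : Tendsto (fun x => f₂ x / f₁ x) atTop (𝓝 1) := by
    have := l₂.div l₁ one_ne_zero
    rw [div_one] at this
    refine this.congr' ?_
    filter_upwards [eventually_gt_atTop 0] with x hx
    have : (m x : ℂ) ≠ 0 := by exact_mod_cast (mpos x hx).ne'
    exact div_div_div_cancel_right₀ this _ _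
  have hinv : ∀ᶠ x : ℝ in atTop, 0 < x ∧ f₁ x ≠ 0 ∧ 1 ≤ (1 / f₁ x ^ 2).re := by
    have e1 : Tendsto (fun x => ((f₁ x / (m x : ℂ))⁻¹ ^ 2).re) atTop (𝓝 1) := by
      have := (Complex.continuous_re.tendsto _).comp ((l₁.inv₀ one_ne_zero).pow 2)
      rw [inv_one, one_pow, Complex.one_re] at this
      exact this
    have e2 := (tendsto_rpow_mul_exp_neg_div_two κ).eventually (ge_mem_nhds (by norm_num : (0:ℝ) < 1 / 2))
    filter_upwards [eventually_gt_atTop 0, l₁.eventually_ne one_ne_zero,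
      e1.eventually (le_mem_nhds (by norm_num : (1 / 2 : ℝ) < 1)), e2] with x hx h0 h1 h2
    have hmx := mpos x hx
    have hf0 : f₁ x ≠ 0 := fun h => h0 (by simp [h])
    refine ⟨hx, hf0, ?_⟩
    have hmc : (m x : ℂ) ≠ 0 := by exact_mod_cast hmx.ne'
    have : 1 / f₁ x ^ 2 = (((m x ^ 2)⁻¹ : ℝ) : ℂ) * (f₁ x / (m x : ℂ))⁻¹ ^ 2 := by
      push_cast
      field_simp
    rw [this, Complex.re_ofReal_mul]
    have hm2 : m x ≤ 1 / 2 := h2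
    have : m x ^ 2 ≤ 1 / 2 := by nlinarith
    rw [inv_mul_eq_div, le_div_iff₀ (by positivity)]
    linarith
  obtain ⟨X, hX⟩ := eventually_atTop.1 hinv
  have hrd : ∀ x, X ≤ x → HasDerivAt (fun y => f₂ y / f₁ y) (D * (1 / f₁ x ^ 2)) x := by
    intro x hx
    obtain ⟨hx0, hfx, -⟩ := hX x hx
    refine ((hg₂ x hx0).1.div (hg₁ x hx0).1 hfx).congr_deriv ?_
    rw [← hD x hx0]
    field_simp
  have hD0 : D = 0 := by
    -- Multiplying by the conjugate of D makes the real part of the derivative |D|² Re(1/f₁²), so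
    -- the real mean value theorem on [x, x+1] applies.
    have hφ : ∀ x, X ≤ x → HasDerivAt (fun y => (starRingEnd ℂ D * (f₂ y / f₁ y)).re)
        (Complex.normSq D * (1 / f₁ x ^ 2).re) x := by
      intro x hx
      have := ((hrd x hx).const_mul (starRingEnd ℂ D))
      have h2 := Complex.reCLM.hasFDerivAt.comp_hasDerivAt x this
      refine h2.congr_deriv ?_
      rw [← mul_assoc, ← Complex.normSq_eq_conj_mul_self, Complex.reCLM_apply,
        Complex.re_ofReal_mul]
    have hlim : Tendsto (fun x : ℝ => (starRingEnd ℂ D * (f₂ (x + 1) / f₁ (x + 1))).re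
        - (starRingEnd ℂ D * (f₂ x / f₁ x)).re) atTop (𝓝 0) := by
      have h1 := (Complex.continuous_re.tendsto _).comp (hr.const_mul (starRingEnd ℂ D))
      have h2 := h1.comp (tendsto_atTop_add_const_right atTop (1 : ℝ) tendsto_id)
      simpa using h2.sub h1
    have hge : Complex.normSq D ≤ 0 := by
      refine ge_of_tendsto hlim ?_
      filter_upwards [eventually_ge_atTop X] with x hx
      obtain ⟨y, hy, hy'⟩ := exists_hasDerivAt_eq_slope
        (fun y => (starRingEnd ℂ D * (f₂ y / f₁ y)).re) _ (lt_add_one x)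
        (fun y hy => (hφ y (hx.trans hy.1)).continuousAt.continuousWithinAt)
        (fun y hy => hφ y (hx.trans hy.1.le))
      rw [add_sub_cancel_left, div_one] at hy'
      rw [← hy']
      exact le_mul_of_one_le_right (Complex.normSq_nonneg D) (hX y (hx.trans hy.1.le)).2.2
    exact Complex.normSq_eq_zero.1 (le_antisymm hge (Complex.normSq_nonneg D))
  have hlarge : ∀ x, X < x → f₁ x = f₂ x := by
    intro x hx
    have hconst : ∀ y, X < y → f₂ y / f₁ y = f₂ x / f₁ x := fun y hy =>
      isOpen_Ioi.is_const_of_deriv_eq_zero isPreconnected_Ioi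
      (fun u hu => (hrd u (le_of_lt hu)).differentiableAt.differentiableWithinAt)
      (fun u hu => by simpa [hD0] using (hrd u (le_of_lt hu)).deriv) hy hx
    have : f₂ x / f₁ x = 1 := tendsto_nhds_unique
      (tendsto_const_nhds.congr' (by
        filter_upwards [eventually_gt_atTop X] with y hy using (hconst y hy).symm)) hr
    exact ((div_eq_one_iff_eq (hX x hx.le).2.1).1 this).symm
  intro x hx
  have hx : 0 < x := hx
  rcases lt_or_ge X x with h | h
  · exact hlarge x h
  -- To the left of X the function f₁ may vanish, so the quotient is no longer available; equality
  -- is carried back from X + 1 by uniqueness for the linear system.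
  have hcont : ContinuousOn (fun x : ℝ => (1 / 4 - (κ : ℂ) / (x : ℂ) + (μ ^ 2 - 1 / 4) / (x : ℂ) ^ 2))
      (Set.Icc x (X + 1)) := by
    have h0 : ∀ y ∈ Set.Icc x (X + 1), (y : ℂ) ≠ 0 := fun y hy => by
      exact_mod_cast (hx.trans_le hy.1).ne'
    have hc : ContinuousOn (fun y : ℝ => (y : ℂ)) (Set.Icc x (X + 1)) := by fun_prop
    exact (continuousOn_const.sub (continuousOn_const.div hc h0)).add
      (continuousOn_const.div (hc.pow 2) fun y hy => pow_ne_zero 2 (h0 y hy))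
  refine eqOn_of_linear_ode (by linarith) hcont
    (fun y hy => (hg₁ y (hx.trans_le hy.1)).1) (fun y hy => (hg₁ y (hx.trans_le hy.1)).2)
    (fun y hy => (hg₂ y (hx.trans_le hy.1)).1) (fun y hy => (hg₂ y (hx.trans_le hy.1)).2)
    (hlarge _ (by linarith)) ?_
  have hev : f₁ =ᶠ[𝓝 (X + 1)] f₂ := by
    filter_upwards [lt_mem_nhds (lt_add_one X)] with y hy using hlarge y hy
  exact (hg₁ (X + 1) (by linarith)).1.unique
    (((hg₂ (X + 1) (by linarith)).1).congr_of_eventuallyEq hev)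

theorem IsWhittakerW.eqOn_whittakerW {κ : ℝ} {μ : ℂ} {f : ℝ → ℂ} (h : IsWhittakerW κ μ f) :
    Set.EqOn (whittakerW κ μ) f (Set.Ioi 0) :=
  IsWhittakerW.eqOn (Classical.epsilon_spec (p := IsWhittakerW κ μ) ⟨f, h⟩) h

/-! ### The first order system behind the functions A and B. -/

/-- Solutions of the first order system `x p' = t q`, `x q' = (x - 2a) q - p`. -/
structure WhittakerSystem (a : ℝ) (t : ℂ) (p q : ℝ → ℂ) : Prop where
  deriv_p : ∀ x : ℝ, 0 < x → HasDerivAt p (t * q x / x) x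
  deriv_q : ∀ x : ℝ, 0 < x → HasDerivAt q (((x - 2 * a) * q x - p x) / x) x

/-- The weight `x ^ a * exp (-x / 2)`. -/
def weight (a x : ℝ) : ℝ := x ^ a * Real.exp (-x / 2)

theorem weight_pos (a : ℝ) {x : ℝ} (hx : 0 < x) : 0 < weight a x := by
  unfold weight; positivity

theorem hasDerivAt_weight (a : ℝ) {x : ℝ} (hx : 0 < x) :
    HasDerivAt (weight a) ((a / x - 1 / 2) * weight a x) x := by
  have h1 := Real.hasDerivAt_rpow_const (x := x) (p := a) (Or.inl hx.ne')
  have h2 : HasDerivAt (fun x : ℝ => Real.exp (-x / 2)) (Real.exp (-x / 2) * (-1 / 2)) x :=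
    ((hasDerivAt_id x).neg.div_const 2).exp
  refine (h1.mul h2).congr_deriv ?_
  rw [weight, Real.rpow_sub_one hx.ne']
  field_simp
  ring

theorem sqrt_mul_weight (a : ℝ) {x : ℝ} (hx : 0 < x) : √x * weight a x = weight (a + 1 / 2) x := by
  rw [weight, weight, Real.rpow_add hx, Real.sqrt_eq_rpow]
  ring

/-- Links the first order system to the Whittaker equation: in the second derivative p' and q' are
eliminated by the system, and t = a² - μ² supplies the coefficient of x^{-2}. The normalisation at
infinity comes from p → 1. -/
theorem WhittakerSystem.isWhittakerW_p {a : ℝ} {t μ : ℂ} {p q : ℝ → ℂ}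
    (h : WhittakerSystem a t p q) (hp : Tendsto p atTop (𝓝 1)) (hμ : t = a ^ 2 - μ ^ 2) :
    IsWhittakerW ((a + 1 / 2 : ℝ) : ℂ) μ fun x => weight (a + 1 / 2) x * p x := by
  refine ⟨⟨fun x => weight (a + 1 / 2) x * (((a + 1 / 2) / x - 1 / 2) * p x + t * q x / x),
    fun x hx => ?_⟩, ?_⟩
  · have hxc : (x : ℂ) ≠ 0 := by exact_mod_cast hx.ne'
    have hm := (hasDerivAt_weight (a + 1 / 2) hx).ofReal_comp
    have hid : HasDerivAt (fun y : ℝ => (y : ℂ)) 1 x := (hasDerivAt_id x).ofReal_comp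
    constructor
    · refine (hm.mul (h.deriv_p x hx)).congr_deriv ?_
      push_cast
      ring
    · have h1 : HasDerivAt (fun y : ℝ => ((a : ℂ) + 1 / 2) / (y : ℂ) - 1 / 2) _ x :=
        ((hasDerivAt_const x ((a : ℂ) + 1 / 2)).div hid hxc).sub_const (1 / 2)
      have h2 : HasDerivAt (fun y : ℝ => t * q y / (y : ℂ)) _ x :=
        ((h.deriv_q x hx).const_mul t).div hid hxc
      refine (hm.mul ((h1.mul (h.deriv_p x hx)).add h2)).congr_deriv ?_
      rw [show μ ^ 2 = a ^ 2 - t by rw [hμ]; ring]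
      push_cast
      simp only [Pi.add_apply, Pi.mul_apply]
      field_simp
      ring
  · refine IsEquivalent.symm ?_
    have h1 : IsEquivalent atTop p fun _ => (1 : ℂ) :=
      (isEquivalent_const_iff_tendsto one_ne_zero).2 hp
    have h2 := (IsEquivalent.refl (u := fun x : ℝ => (weight (a + 1 / 2) x : ℂ)) (l := atTop)).mul h1
    refine (h2.symm.congr_left ?_)
    filter_upwards [eventually_gt_atTop 0] with x hx
    rw [whittaker_weight_eq _ hx]
    simp [weight]

/-- The weight is the same as for p; the index κ drops by one because q decays like 1/x. -/
theorem WhittakerSystem.isWhittakerW_q {a : ℝ} {t μ : ℂ} {p q : ℝ → ℂ}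
    (h : WhittakerSystem a t p q) (hq : Tendsto (fun x : ℝ => x * q x) atTop (𝓝 1))
    (hμ : t = a ^ 2 - μ ^ 2) :
    IsWhittakerW ((a - 1 / 2 : ℝ) : ℂ) μ fun x => weight (a + 1 / 2) x * q x := by
  refine ⟨⟨fun x => weight (a + 1 / 2) x * (((a + 1 / 2) / x - 1 / 2) * q x +
    ((x - 2 * a) * q x - p x) / x), fun x hx => ?_⟩, ?_⟩
  · have hxc : (x : ℂ) ≠ 0 := by exact_mod_cast hx.ne'
    have hm := (hasDerivAt_weight (a + 1 / 2) hx).ofReal_comp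
    have hid : HasDerivAt (fun y : ℝ => (y : ℂ)) 1 x := (hasDerivAt_id x).ofReal_comp
    constructor
    · refine (hm.mul (h.deriv_q x hx)).congr_deriv ?_
      push_cast
      ring
    · have h1 : HasDerivAt (fun y : ℝ => ((a : ℂ) + 1 / 2) / (y : ℂ) - 1 / 2) _ x :=
        ((hasDerivAt_const x ((a : ℂ) + 1 / 2)).div hid hxc).sub_const (1 / 2)
      have h2 : HasDerivAt (fun y : ℝ => (((y : ℂ) - 2 * a) * q y - p y) / (y : ℂ)) _ x :=
        (((hid.sub_const (2 * (a : ℂ))).mul (h.deriv_q x hx)).sub (h.deriv_p x hx)).div hid hxc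
      refine (hm.mul ((h1.mul (h.deriv_q x hx)).add h2)).congr_deriv ?_
      rw [show μ ^ 2 = a ^ 2 - t by rw [hμ]; ring]
      push_cast
      simp only [Pi.add_apply, Pi.mul_apply, Pi.sub_apply]
      field_simp
      ring
  · refine IsEquivalent.symm ?_
    have h1 : IsEquivalent atTop (fun x : ℝ => x * q x) fun _ => (1 : ℂ) :=
      (isEquivalent_const_iff_tendsto one_ne_zero).2 hq
    have h2 := (IsEquivalent.refl (u := fun x : ℝ => (weight (a - 1 / 2) x : ℂ)) (l := atTop)).mul h1
    refine ((h2.symm.congr_left ?_).congr_right ?_)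
    · filter_upwards [eventually_gt_atTop 0] with x hx
      rw [whittaker_weight_eq _ hx]
      simp [weight]
    · filter_upwards [eventually_gt_atTop 0] with x hx
      have : weight (a + 1 / 2) x = weight (a - 1 / 2) x * x := by
        rw [weight, weight, show a + 1 / 2 = (a - 1 / 2) + 1 by ring, Real.rpow_add_one hx.ne']
        ring
      rw [this]
      simp only [Pi.mul_apply]
      push_cast
      ring

/-! ### Tricomi's integral: bounds, derivative, recurrence, asymptotics. -/

theorem integral_Ioi_deriv_eq_zero {f f' : ℝ → ℂ} (hd : ∀ x : ℝ, 0 < x → HasDerivAt f (f' x) x)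
    (hi : IntegrableOn f' (Set.Ioi 0)) (h0 : Tendsto f (𝓝[>] 0) (𝓝 0))
    (htop : Tendsto f atTop (𝓝 0)) : ∫ x in Set.Ioi 0, f' x = 0 := by
  -- The value of f at 0 is arbitrary, so it is replaced by the limit 0 to obtain continuity at the
  -- endpoint.
  have hc : ContinuousWithinAt (Function.update f 0 0) (Set.Ici 0) 0 := by
    rw [continuousWithinAt_update_same]
    refine h0.mono_left (nhdsWithin_mono _ ?_)
    rintro x ⟨hx, hx'⟩
    exact lt_of_le_of_ne hx (Ne.symm hx')
  have := integral_Ioi_of_hasDerivAt_of_tendsto hc (f' := f') (m := 0) (fun x hx => ?_) hi ?_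
  · simpa using this
  · refine (hd x hx).congr_of_eventuallyEq ?_
    filter_upwards [lt_mem_nhds (Set.mem_Ioi.1 hx)] with y hy
    exact Function.update_of_ne hy.ne' _ _
  · refine htop.congr' ?_
    filter_upwards [eventually_gt_atTop 0] with y hy
    exact (Function.update_of_ne hy.ne' _ _).symm

theorem integrableOn_rpow_mul_exp_neg {s x : ℝ} (hs : 0 < s) (hx : 0 < x) :
    IntegrableOn (fun τ : ℝ => τ ^ (s - 1) * Real.exp (-(x * τ))) (Set.Ioi 0) := by
  have := integrableOn_rpow_mul_exp_neg_mul_rpow (s := s - 1) (by linarith) zero_lt_one hx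
  simpa [neg_mul] using this

/-- The integrand of Tricomi's integral. -/
def tricomiKernel (α β : ℂ) (x τ : ℝ) : ℂ :=
  (τ : ℂ) ^ (α - 1) * ((1 + τ : ℝ) : ℂ) ^ β * Complex.exp (-(x * τ))

/-- The integral `∫₀^∞ τ ^ (α - 1) (1 + τ) ^ β exp (-x τ) dτ`. -/
def tricomiIntegral (α β : ℂ) (x : ℝ) : ℂ := ∫ τ in Set.Ioi 0, tricomiKernel α β x τ

theorem norm_exp_neg_mul (x τ : ℝ) : ‖Complex.exp (-((x : ℂ) * τ))‖ = Real.exp (-(x * τ)) := by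
  rw [Complex.norm_exp]
  simp

/-- For 0 ≤ ν ≤ -Re β one has (1+τ)^{Re β} ≤ τ^{-ν}. The free exponent ν interpolates between the
sharp decay of the integral at infinity (ν = 0) and a milder singularity at 0 (larger ν). -/
theorem norm_tricomiKernel_le {α β : ℂ} {ν : ℝ} (hν : 0 ≤ ν) (hβ : ν ≤ -β.re) (x : ℝ) {τ : ℝ}
    (hτ : 0 < τ) :
    ‖tricomiKernel α β x τ‖ ≤ τ ^ (α.re - ν - 1) * Real.exp (-(x * τ)) := by
  rw [tricomiKernel, norm_mul, norm_mul, norm_exp_neg_mul,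
    Complex.norm_cpow_eq_rpow_re_of_pos hτ, Complex.norm_cpow_eq_rpow_re_of_pos (by linarith)]
  gcongr
  rw [show α.re - ν - 1 = (α - 1).re + -ν by simp; ring, Real.rpow_add hτ]
  gcongr
  calc (1 + τ) ^ β.re ≤ (1 + τ) ^ (-ν) :=
        Real.rpow_le_rpow_of_exponent_le (by linarith) (by linarith)
    _ ≤ τ ^ (-ν) := Real.rpow_le_rpow_of_nonpos hτ (by linarith) (by linarith)

theorem continuousOn_ofReal_cpow (α : ℂ) :
    ContinuousOn (fun τ : ℝ => (τ : ℂ) ^ α) (Set.Ioi 0) := fun τ hτ =>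
  (Complex.continuousAt_ofReal_cpow_const τ α (Or.inr (ne_of_gt hτ))).continuousWithinAt

theorem continuousOn_one_add_cpow (β : ℂ) :
    ContinuousOn (fun τ : ℝ => ((1 + τ : ℝ) : ℂ) ^ β) (Set.Ioi 0) :=
  (continuousOn_ofReal_cpow β).comp (by fun_prop) fun τ hτ => by
    have : 0 < τ := hτ
    exact Set.mem_Ioi.2 (by linarith)

theorem continuousOn_tricomiKernel (α β : ℂ) (x : ℝ) :
    ContinuousOn (tricomiKernel α β x) (Set.Ioi 0) :=
  ((continuousOn_ofReal_cpow _).mul (continuousOn_one_add_cpow β)).mul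
    (by fun_prop)

theorem aestronglyMeasurable_tricomiKernel (α β : ℂ) (x : ℝ) :
    AEStronglyMeasurable (tricomiKernel α β x) (volume.restrict (Set.Ioi 0)) :=
  (continuousOn_tricomiKernel α β x).aestronglyMeasurable measurableSet_Ioi

theorem integrableOn_tricomiKernel {α β : ℂ} (hα : 0 < α.re) (hβ : β.re ≤ 0) {x : ℝ} (hx : 0 < x) :
    IntegrableOn (tricomiKernel α β x) (Set.Ioi 0) := by
  refine (integrableOn_rpow_mul_exp_neg hα hx).mono'
    (aestronglyMeasurable_tricomiKernel α β x) ?_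
  filter_upwards [ae_restrict_mem measurableSet_Ioi] with τ hτ
  simpa using norm_tricomiKernel_le (α := α) le_rfl (by linarith) x hτ

theorem norm_tricomiIntegral_le {α β : ℂ} {ν : ℝ} (hν : 0 ≤ ν) (hβ : ν ≤ -β.re) (hα : ν < α.re)
    {x : ℝ} (hx : 0 < x) :
    ‖tricomiIntegral α β x‖ ≤ Real.Gamma (α.re - ν) * x ^ (ν - α.re) := by
  have h := norm_integral_le_of_norm_le (integrableOn_rpow_mul_exp_neg (s := α.re - ν)
    (by linarith) hx) (f := tricomiKernel α β x) (by
      filter_upwards [ae_restrict_mem measurableSet_Ioi] with τ hτ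
      exact norm_tricomiKernel_le hν hβ x hτ)
  refine h.trans_eq ?_
  rw [Real.integral_rpow_mul_exp_neg_mul_Ioi (by linarith) hx, one_div, Real.inv_rpow hx.le,
    ← Real.rpow_neg hx.le, neg_sub, mul_comm]

theorem tricomiKernel_add_one (α β : ℂ) (x : ℝ) {τ : ℝ} (hτ : 0 < τ) :
    tricomiKernel (α + 1) β x τ = τ * tricomiKernel α β x τ := by
  have : (τ : ℂ) ≠ 0 := by exact_mod_cast hτ.ne'
  rw [tricomiKernel, tricomiKernel, add_sub_right_comm, Complex.cpow_add _ _ this,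
    Complex.cpow_one]
  ring

theorem hasDerivAt_tricomiIntegral {α β : ℂ} (hα : 0 < α.re) (hβ : β.re ≤ 0) {x : ℝ} (hx : 0 < x) :
    HasDerivAt (tricomiIntegral α β) (-tricomiIntegral (α + 1) β x) x := by
  have h := hasDerivAt_integral_of_dominated_loc_of_deriv_le (μ := volume.restrict (Set.Ioi 0))
    (F := tricomiKernel α β) (F' := fun x τ => -tricomiKernel (α + 1) β x τ) (x₀ := x)
    (bound := fun τ => τ ^ ((α.re + 1) - 1) * Real.exp (-(x / 2 * τ)))
    (lt_mem_nhds (half_lt_self hx))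
    (Eventually.of_forall fun y => aestronglyMeasurable_tricomiKernel α β y)
    (integrableOn_tricomiKernel hα hβ hx)
    (aestronglyMeasurable_tricomiKernel (α + 1) β x).neg ?_
    (integrableOn_rpow_mul_exp_neg (by linarith) (half_pos hx)) ?_
  · have h2 := h.2
    rw [integral_neg] at h2
    exact h2
  · filter_upwards [ae_restrict_mem measurableSet_Ioi] with τ hτ y hy
    have hτ : 0 < τ := hτ
    rw [norm_neg]
    refine (norm_tricomiKernel_le (α := α + 1) le_rfl (by linarith) y hτ).trans ?_
    simp only [Complex.add_re, Complex.one_re, sub_zero]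
    have hy : x / 2 < y := hy
    gcongr
  · filter_upwards [ae_restrict_mem measurableSet_Ioi] with τ hτ y hy
    rw [tricomiKernel_add_one α β y hτ]
    have h1 : HasDerivAt (fun y : ℝ => Complex.exp (-((y : ℂ) * τ)))
        (Complex.exp (-((y : ℂ) * τ)) * -(1 * τ)) y :=
      (((hasDerivAt_id y).ofReal_comp.mul_const (τ : ℂ)).neg).cexp
    refine (h1.const_mul ((τ : ℂ) ^ (α - 1) * ((1 + τ : ℝ) : ℂ) ^ β)).congr_deriv ?_
    rw [tricomiKernel]
    ring

theorem hasDerivAt_ofReal_cpow {r : ℂ} (hr : r ≠ 0) {x : ℝ} (hx : 0 < x) :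
    HasDerivAt (fun y : ℝ => (y : ℂ) ^ r) (r * (x : ℂ) ^ r / x) x := by
  have := hasDerivAt_ofReal_cpow_const hx.ne' hr
  rwa [Complex.cpow_sub _ _ (by exact_mod_cast hx.ne'), Complex.cpow_one, ← mul_div_assoc] at this

theorem hasDerivAt_one_add_cpow (β : ℂ) {y : ℝ} (hy : 0 ≤ y) :
    HasDerivAt (fun y : ℝ => ((1 + y : ℝ) : ℂ) ^ β) (β * ((1 + y : ℝ) : ℂ) ^ (β - 1)) y := by
  have h : HasDerivAt (fun u : ℂ => (1 + u) ^ β) (β * (1 + (y : ℂ)) ^ (β - 1) * 1) (y : ℂ) :=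
    ((hasDerivAt_id (y : ℂ)).const_add 1).cpow_const (Or.inl (by
      simp only [id, Complex.add_re, Complex.one_re, Complex.ofReal_re]; linarith))
  simpa using h.comp_ofReal

/-- A contiguous relation: the derivative of τ^α (1+τ)^{β+1} e^{-xτ} integrates to 0. -/
theorem tricomiIntegral_recurrence {α β : ℂ} (hα : 0 < α.re) (hβ : β.re ≤ 0) {x : ℝ}
    (hx : 0 < x) :
    x * tricomiIntegral (α + 2) β x =
      α * tricomiIntegral α β x + (α + β + 1 - x) * tricomiIntegral (α + 1) β x := by
  have hα0 : α ≠ 0 := fun h => by simp [h] at hα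
  have i0 := integrableOn_tricomiKernel hα hβ hx
  have i1 := integrableOn_tricomiKernel (α := α + 1) (by simp; linarith) hβ hx
  have i2 := integrableOn_tricomiKernel (α := α + 2) (by simp; linarith) hβ hx
  have key := integral_Ioi_deriv_eq_zero
    (f := fun τ : ℝ => (τ : ℂ) * tricomiKernel α β x τ * (1 + τ))
    (f' := fun τ => α * tricomiKernel α β x τ + (α + β + 1 - x) * tricomiKernel (α + 1) β x τ
      - x * tricomiKernel (α + 2) β x τ) ?_ ?_ ?_ ?_
  · rw [integral_sub, integral_add, integral_const_mul, integral_const_mul,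
      integral_const_mul] at key
    · exact (sub_eq_zero.1 key).symm
    · exact i0.const_mul _
    · exact i1.const_mul _
    · exact (i0.const_mul _).add (i1.const_mul _)
    · exact i2.const_mul _
  · intro τ hτ
    have hτc : (τ : ℂ) ≠ 0 := by exact_mod_cast hτ.ne'
    have h1τ : ((1 + τ : ℝ) : ℂ) ≠ 0 := by exact_mod_cast (by linarith : 1 + τ ≠ 0)
    have hid : HasDerivAt (fun y : ℝ => (y : ℂ)) 1 τ := (hasDerivAt_id τ).ofReal_comp
    have d1 := hasDerivAt_ofReal_cpow hα0 hτ
    have d2 : HasDerivAt (fun y : ℝ => ((1 + y : ℝ) : ℂ) ^ (β + 1))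
        ((β + 1) * ((1 + τ : ℝ) : ℂ) ^ β) τ := by
      simpa using hasDerivAt_one_add_cpow (β + 1) hτ.le
    have d3 : HasDerivAt (fun y : ℝ => Complex.exp (-((x : ℂ) * y)))
        (Complex.exp (-((x : ℂ) * τ)) * -(x * 1)) τ := ((hid.const_mul (x : ℂ)).neg).cexp
    have d := (d1.mul d2).mul d3
    have e2 : tricomiKernel (α + 2) β x τ = τ * (τ * tricomiKernel α β x τ) := by
      rw [show α + 2 = α + 1 + 1 by ring, tricomiKernel_add_one _ _ _ hτ,
        tricomiKernel_add_one _ _ _ hτ]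
    rw [e2, tricomiKernel_add_one _ _ _ hτ]
    have ef : ∀ y : ℝ, 0 < y → (y : ℂ) * tricomiKernel α β x y * (1 + y) =
        (y : ℂ) ^ α * ((1 + y : ℝ) : ℂ) ^ (β + 1) * Complex.exp (-((x : ℂ) * y)) := by
      intro y hy
      have hyc : (y : ℂ) ≠ 0 := by exact_mod_cast hy.ne'
      have h1y : ((1 + y : ℝ) : ℂ) ≠ 0 := by exact_mod_cast (by linarith : 1 + y ≠ 0)
      rw [tricomiKernel, Complex.cpow_sub _ _ hyc, Complex.cpow_add _ _ h1y, Complex.cpow_one,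
        Complex.cpow_one]
      push_cast
      field_simp
    refine (d.congr_of_eventuallyEq ?_).congr_deriv ?_
    · filter_upwards [lt_mem_nhds hτ] with y hy using ef y hy
    · rw [tricomiKernel, Complex.cpow_sub _ _ hτc, Complex.cpow_add _ _ h1τ, Complex.cpow_one,
        Complex.cpow_one]
      simp only [Pi.mul_apply]
      rw [Complex.cpow_add _ _ h1τ, Complex.cpow_one]
      push_cast
      field_simp
      ring
  · exact ((i0.const_mul _).add (i1.const_mul _)).sub (i2.const_mul _)
  · have hb : ∀ τ : ℝ, 0 < τ → ‖(τ : ℂ) * tricomiKernel α β x τ * (1 + τ)‖ ≤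
        τ ^ α.re * (1 + τ) := by
      intro τ hτ
      rw [norm_mul, norm_mul, Complex.norm_of_nonneg hτ.le]
      have h1 := norm_tricomiKernel_le (α := α) (β := β) le_rfl (by linarith) x hτ
      rw [sub_zero] at h1
      have h2 : Real.exp (-(x * τ)) ≤ 1 := Real.exp_le_one_iff.2 (by have := mul_pos hx hτ; linarith)
      have h3 : ‖(1 + τ : ℂ)‖ = 1 + τ := by
        rw [← Complex.ofReal_one, ← Complex.ofReal_add, Complex.norm_of_nonneg (by linarith)]
      rw [h3]
      gcongr
      calc τ * ‖tricomiKernel α β x τ‖ ≤ τ * (τ ^ (α.re - 1) * 1) := by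
            gcongr
            exact h1.trans (by gcongr)
        _ = τ ^ α.re := by rw [Real.rpow_sub_one hτ.ne']; field_simp
    refine squeeze_zero_norm' (a := fun τ : ℝ => τ ^ α.re * (1 + τ)) ?_ ?_
    · filter_upwards [self_mem_nhdsWithin] with τ hτ using hb τ hτ
    · have : Tendsto (fun τ : ℝ => τ ^ α.re * (1 + τ)) (𝓝 0) (𝓝 ((0 : ℝ) ^ α.re * (1 + 0))) :=
        ((Real.continuousAt_rpow_const 0 α.re (Or.inr hα.le)).mul
          (by fun_prop : ContinuousAt (fun τ : ℝ => 1 + τ) 0))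
      rw [Real.zero_rpow hα.ne', zero_mul] at this
      exact this.mono_left nhdsWithin_le_nhds
  · refine squeeze_zero_norm' (a := fun τ : ℝ => τ ^ α.re * Real.exp (-x * τ) +
      τ ^ (α.re + 1) * Real.exp (-x * τ)) ?_ ?_
    · filter_upwards [eventually_gt_atTop 0] with τ hτ
      rw [norm_mul, norm_mul, Complex.norm_of_nonneg hτ.le]
      have h1 := norm_tricomiKernel_le (α := α) (β := β) le_rfl (by linarith) x hτ
      rw [sub_zero] at h1
      have h3 : ‖(1 + τ : ℂ)‖ = 1 + τ := by
        rw [← Complex.ofReal_one, ← Complex.ofReal_add, Complex.norm_of_nonneg (by linarith)]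
      rw [h3]
      calc τ * ‖tricomiKernel α β x τ‖ * (1 + τ)
          ≤ τ * (τ ^ (α.re - 1) * Real.exp (-(x * τ))) * (1 + τ) := by gcongr
        _ = _ := by
          rw [Real.rpow_sub_one hτ.ne', Real.rpow_add_one hτ.ne', neg_mul]
          field_simp
    · simpa using (tendsto_rpow_mul_exp_neg_mul_atTop_nhds_zero α.re x hx).add
        (tendsto_rpow_mul_exp_neg_mul_atTop_nhds_zero (α.re + 1) x hx)

theorem norm_one_add_cpow_sub_one_le {β : ℂ} (hβ : β.re ≤ 1) {τ : ℝ} (hτ : 0 ≤ τ) :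
    ‖((1 + τ : ℝ) : ℂ) ^ β - 1‖ ≤ ‖β‖ * τ := by
  have h := Convex.norm_image_sub_le_of_norm_hasDerivWithin_le (𝕜 := ℝ)
    (f := fun y : ℝ => ((1 + y : ℝ) : ℂ) ^ β) (f' := fun y => β * ((1 + y : ℝ) : ℂ) ^ (β - 1))
    (s := Set.Ici 0) (x := 0) (y := τ) (C := ‖β‖) ?_ ?_ (convex_Ici 0) Set.self_mem_Ici hτ
  · simpa [abs_of_nonneg hτ] using h
  · intro y hy
    have hy : 0 ≤ y := hy
    exact (hasDerivAt_one_add_cpow β hy).hasDerivWithinAt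
  · intro y hy
    have hy : 0 ≤ y := hy
    rw [norm_mul, Complex.norm_cpow_eq_rpow_re_of_pos (by linarith)]
    exact mul_le_of_le_one_right (norm_nonneg _)
      (Real.rpow_le_one_of_one_le_of_nonpos (by linarith) (by simp; linarith))

/-- For β = 0 the product is exactly Γ(α). The error is controlled by |(1+τ)^β - 1| ≤ |β| τ, and the
extra factor τ gains a factor 1/x. -/
theorem tendsto_cpow_mul_tricomiIntegral {α β : ℂ} (hα : 0 < α.re) (hβ : β.re ≤ 0) :
    Tendsto (fun x : ℝ => (x : ℂ) ^ α * tricomiIntegral α β x) atTop (𝓝 (Complex.Gamma α)) := by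
  have hb : ∀ x : ℝ, 0 < x → ‖(x : ℂ) ^ α * tricomiIntegral α β x - Complex.Gamma α‖ ≤
      ‖β‖ * Real.Gamma (α.re + 1) * x⁻¹ := by
    intro x hx
    have hxc : (x : ℂ) ≠ 0 := by exact_mod_cast hx.ne'
    have i0 := integrableOn_tricomiKernel hα hβ hx
    have i1 := integrableOn_tricomiKernel (α := α) (β := 0) hα le_rfl hx
    have hG : Complex.Gamma α = (x : ℂ) ^ α * ∫ τ in Set.Ioi 0, tricomiKernel α 0 x τ := by
      have h := Complex.integral_cpow_mul_exp_neg_mul_Ioi hα hx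
      simp only [tricomiKernel, Complex.cpow_zero, mul_one]
      have e := Complex.mul_cpow_ofReal_nonneg hx.le (inv_nonneg.2 hx.le) α
      rw [Complex.ofReal_inv, mul_inv_cancel₀ hxc, Complex.one_cpow] at e
      rw [h, one_div, ← mul_assoc, ← e, one_mul]
    rw [hG, tricomiIntegral, ← mul_sub, ← integral_sub i0 i1, norm_mul,
      Complex.norm_cpow_eq_rpow_re_of_pos hx]
    have h := norm_integral_le_of_norm_le (μ := volume.restrict (Set.Ioi 0))
      ((integrableOn_rpow_mul_exp_neg (s := α.re + 1) (by linarith) hx).const_mul ‖β‖)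
      (f := fun τ => tricomiKernel α β x τ - tricomiKernel α 0 x τ) (by
        filter_upwards [ae_restrict_mem measurableSet_Ioi] with τ hτ
        have hτ : 0 < τ := hτ
        have : tricomiKernel α β x τ - tricomiKernel α 0 x τ =
            (τ : ℂ) ^ (α - 1) * (((1 + τ : ℝ) : ℂ) ^ β - 1) * Complex.exp (-(x * τ)) := by
          simp only [tricomiKernel, Complex.cpow_zero]
          ring
        rw [this, norm_mul, norm_mul, norm_exp_neg_mul, Complex.norm_cpow_eq_rpow_re_of_pos hτ]
        calc τ ^ (α - 1).re * ‖((1 + τ : ℝ) : ℂ) ^ β - 1‖ * Real.exp (-(x * τ))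
            ≤ τ ^ (α - 1).re * (‖β‖ * τ) * Real.exp (-(x * τ)) := by
              gcongr
              exact norm_one_add_cpow_sub_one_le (by linarith) hτ.le
          _ = _ := by
              rw [show α.re + 1 - 1 = (α - 1).re + 1 by simp, Real.rpow_add_one hτ.ne']
              ring)
    rw [integral_const_mul, Real.integral_rpow_mul_exp_neg_mul_Ioi (by linarith) hx, one_div,
      Real.inv_rpow hx.le, ← Real.rpow_neg hx.le] at h
    calc _ ≤ x ^ α.re * (‖β‖ * (x ^ (-(α.re + 1)) * Real.Gamma (α.re + 1))) := by gcongr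
      _ = _ := by
        rw [Real.rpow_neg hx.le, Real.rpow_add_one hx.ne']
        have : x ^ α.re ≠ 0 := by positivity
        field_simp
  rw [tendsto_iff_norm_sub_tendsto_zero]
  refine squeeze_zero' (Eventually.of_forall fun _ => norm_nonneg _)
    (by filter_upwards [eventually_gt_atTop 0] with x hx using hb x hx) ?_
  simpa using tendsto_inv_atTop_zero.const_mul (‖β‖ * Real.Gamma (α.re + 1))

/-! ### Mellin transforms. -/

theorem integrableOn_rpow_mul_one_add_rpow {s r : ℝ} (hs : -1 < s) (hr : s + r < -1) :
    IntegrableOn (fun τ : ℝ => τ ^ s * (1 + τ) ^ r) (Set.Ioi 0) := by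
  have hcont : ContinuousOn (fun τ : ℝ => τ ^ s * (1 + τ) ^ r) (Set.Ioi 0) := by
    intro τ hτ
    have hτ : 0 < τ := hτ
    exact ((Real.continuousAt_rpow_const τ s (Or.inl hτ.ne')).mul
      ((by fun_prop : ContinuousAt (fun τ : ℝ => 1 + τ) τ).rpow_const
        (Or.inl (by linarith)))).continuousWithinAt
  rw [← Set.Ioc_union_Ioi_eq_Ioi zero_le_one]
  refine IntegrableOn.union ?_ ?_
  · have h1 : IntegrableOn (fun τ : ℝ => max 1 (2 ^ r) * τ ^ s) (Set.Ioc 0 1) := by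
      have := (intervalIntegral.intervalIntegrable_rpow' hs (a := 0) (b := 1)).1
      exact this.const_mul _
    refine h1.mono' ((hcont.mono Set.Ioc_subset_Ioi_self).aestronglyMeasurable
      measurableSet_Ioc) ?_
    filter_upwards [ae_restrict_mem measurableSet_Ioc] with τ hτ
    have h0 : 0 < τ := hτ.1
    rw [Real.norm_of_nonneg (by positivity), mul_comm]
    gcongr
    rcases le_total 0 r with h | h
    · exact (Real.rpow_le_rpow (by positivity) (by linarith [hτ.2]) h).trans (le_max_right _ _)
    · exact (Real.rpow_le_one_of_one_le_of_nonpos (by linarith) h).trans (le_max_left _ _)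
  · have h1 : IntegrableOn (fun τ : ℝ => max 1 (2 ^ r) * τ ^ (s + r)) (Set.Ioi 1) :=
      (integrableOn_Ioi_rpow_of_lt hr one_pos).const_mul _
    refine h1.mono' ((hcont.mono (Set.Ioi_subset_Ioi zero_le_one)).aestronglyMeasurable
      measurableSet_Ioi) ?_
    filter_upwards [ae_restrict_mem measurableSet_Ioi] with τ hτ
    have h1 : 1 < τ := hτ
    have h0 : 0 < τ := by linarith
    rw [Real.norm_of_nonneg (by positivity), Real.rpow_add h0, mul_left_comm]
    gcongr
    rcases le_total 0 r with h | h
    · calc (1 + τ) ^ r ≤ (2 * τ) ^ r := Real.rpow_le_rpow (by positivity) (by linarith) h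
        _ = 2 ^ r * τ ^ r := Real.mul_rpow (by norm_num) h0.le
        _ ≤ _ := by gcongr; exact le_max_right _ _
    · calc (1 + τ) ^ r ≤ τ ^ r := Real.rpow_le_rpow_of_nonpos h0 (by linarith) h
        _ ≤ _ := le_mul_of_one_le_left (by positivity) (le_max_left _ _)

theorem norm_ofReal_cpow {x : ℝ} (hx : 0 < x) (r : ℂ) : ‖(x : ℂ) ^ r‖ = x ^ r.re :=
  Complex.norm_cpow_eq_rpow_re_of_pos hx r

/-- The Mellin transform of `exp (-u)` times Tricomi's integral. -/
theorem integral_cpow_mul_exp_mul_tricomiIntegral {α β γ : ℂ} (hα : 0 < α.re) (hγ : 0 < γ.re)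
    (hβ : (α + β - γ).re < 0) :
    ∫ u : ℝ in Set.Ioi 0, (u : ℂ) ^ (γ - 1) * Complex.exp (-u) * tricomiIntegral α β u =
      Complex.Gamma γ * ∫ τ : ℝ in Set.Ioi 0, (τ : ℂ) ^ (α - 1) * ((1 + τ : ℝ) : ℂ) ^ (β - γ) := by
  set H : ℝ → ℝ → ℂ := fun u τ =>
    (u : ℂ) ^ (γ - 1) * Complex.exp (-u) * tricomiKernel α β u τ with hH
  -- The exponentials combine to e^{-(1+τ)u}, so after Fubini the integral over u is Γ(γ)(1+τ)^{-γ}.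
  have hH' : ∀ u τ : ℝ, H u τ = (τ : ℂ) ^ (α - 1) * ((1 + τ : ℝ) : ℂ) ^ β *
      ((u : ℂ) ^ (γ - 1) * Complex.exp (-(((1 + τ : ℝ) : ℂ) * u))) := by
    intro u τ
    simp only [hH, tricomiKernel]
    rw [show -(((1 + τ : ℝ) : ℂ) * u) = -(u : ℂ) + -(u * τ) by push_cast; ring, Complex.exp_add]
    ring
  have hcont : ContinuousOn (Function.uncurry H) (Set.Ioi 0 ×ˢ Set.Ioi 0) := by
    have e1 : ContinuousOn (fun p : ℝ × ℝ => (p.1 : ℂ) ^ (γ - 1)) (Set.Ioi 0 ×ˢ Set.Ioi 0) :=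
      (continuousOn_ofReal_cpow _).comp continuousOn_fst fun p hp => hp.1
    have e2 : ContinuousOn (fun p : ℝ × ℝ => (p.2 : ℂ) ^ (α - 1)) (Set.Ioi 0 ×ˢ Set.Ioi 0) :=
      (continuousOn_ofReal_cpow _).comp continuousOn_snd fun p hp => hp.2
    have e3 : ContinuousOn (fun p : ℝ × ℝ => ((1 + p.2 : ℝ) : ℂ) ^ β) (Set.Ioi 0 ×ˢ Set.Ioi 0) :=
      (continuousOn_one_add_cpow _).comp continuousOn_snd fun p hp => hp.2
    have e4 : ContinuousOn (fun p : ℝ × ℝ => Complex.exp (-(p.1 : ℂ))) (Set.Ioi 0 ×ˢ Set.Ioi 0) := by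
      fun_prop
    have e5 : ContinuousOn (fun p : ℝ × ℝ => Complex.exp (-((p.1 : ℂ) * p.2)))
        (Set.Ioi 0 ×ˢ Set.Ioi 0) := by
      fun_prop
    exact (e1.mul e4).mul ((e2.mul e3).mul e5)
  have hint : Integrable (Function.uncurry H)
      ((volume.restrict (Set.Ioi 0)).prod (volume.restrict (Set.Ioi 0))) := by
    have hm : AEStronglyMeasurable (Function.uncurry H)
        ((volume.restrict (Set.Ioi 0)).prod (volume.restrict (Set.Ioi 0))) := by
      rw [Measure.prod_restrict]
      exact hcont.aestronglyMeasurable (measurableSet_Ioi.prod measurableSet_Ioi)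
    have hn : ∀ τ : ℝ, 0 < τ → ∀ u : ℝ, 0 < u → ‖H u τ‖ = τ ^ (α - 1).re * (1 + τ) ^ β.re *
        (u ^ (γ.re - 1) * Real.exp (-((1 + τ) * u))) := by
      intro τ hτ u hu
      rw [hH', norm_mul, norm_mul, norm_mul, norm_exp_neg_mul, norm_ofReal_cpow hτ,
        norm_ofReal_cpow hu, norm_ofReal_cpow (by linarith)]
      simp
    rw [integrable_prod_iff' hm]
    constructor
    · filter_upwards [ae_restrict_mem measurableSet_Ioi] with τ hτ
      have hτ : 0 < τ := hτ
      refine ((integrableOn_rpow_mul_exp_neg (x := 1 + τ) hγ (by linarith)).const_mul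
        (τ ^ (α - 1).re * (1 + τ) ^ β.re)).mono' ?_ ?_
      · refine ContinuousOn.aestronglyMeasurable ?_ measurableSet_Ioi
        exact hcont.comp (by fun_prop) fun u hu => ⟨hu, hτ⟩
      · filter_upwards [ae_restrict_mem measurableSet_Ioi] with u hu
        exact (hn τ hτ u hu).le
    · refine ((integrableOn_rpow_mul_one_add_rpow (s := α.re - 1) (r := β.re - γ.re)
        (by linarith) (by simp at hβ; linarith)).const_mul (Real.Gamma γ.re)).congr ?_
      filter_upwards [ae_restrict_mem measurableSet_Ioi] with τ hτ
      have hτ : 0 < τ := hτ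
      have : ∫ u, ‖Function.uncurry H (u, τ)‖ ∂volume.restrict (Set.Ioi 0) =
          ∫ u in Set.Ioi 0, τ ^ (α - 1).re * (1 + τ) ^ β.re *
        (u ^ (γ.re - 1) * Real.exp (-((1 + τ) * u))) :=
        setIntegral_congr_fun measurableSet_Ioi fun u hu => hn τ hτ u hu
      rw [this, integral_const_mul, Real.integral_rpow_mul_exp_neg_mul_Ioi hγ (by linarith),
        one_div, Real.inv_rpow (by linarith), Real.rpow_sub (by linarith : 0 < 1 + τ)]
      simp only [Complex.sub_re, Complex.one_re]
      ring
  calc _ = ∫ u : ℝ in Set.Ioi 0, ∫ τ : ℝ in Set.Ioi 0, H u τ := by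
        simp only [hH, integral_const_mul, tricomiIntegral]
    _ = ∫ τ : ℝ in Set.Ioi 0, ∫ u : ℝ in Set.Ioi 0, H u τ := integral_integral_swap hint
    _ = ∫ τ : ℝ in Set.Ioi 0, Complex.Gamma γ *
          ((τ : ℂ) ^ (α - 1) * ((1 + τ : ℝ) : ℂ) ^ (β - γ)) := by
        refine setIntegral_congr_fun measurableSet_Ioi fun τ hτ => ?_
        have hτ : 0 < τ := hτ
        have h1τ : ((1 + τ : ℝ) : ℂ) ≠ 0 := by exact_mod_cast (by linarith : 1 + τ ≠ 0)
        simp only [hH', integral_const_mul]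
        rw [Complex.integral_cpow_mul_exp_neg_mul_Ioi hγ (by linarith), Complex.cpow_sub _ _ h1τ,
          one_div, Complex.inv_cpow _ _ (by
            rw [Complex.arg_ofReal_of_nonneg (by linarith)]; exact Real.pi_pos.ne)]
        ring
    _ = _ := integral_const_mul _ _

/-- This Beta integral is read off from the Mellin formula at β = 0, γ = 2, where Tricomi's integral
is elementary and the left side is an integral for Γ(1+z). -/
theorem integral_cpow_mul_one_add_cpow_neg_two {z : ℂ} (hz : z.re < 1) (hz' : -1 < z.re) :
    ∫ τ : ℝ in Set.Ioi 0, (τ : ℂ) ^ (-z) * ((1 + τ : ℝ) : ℂ) ^ (-2 : ℂ) =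
      Complex.Gamma (1 - z) * Complex.Gamma (1 + z) := by
  have h := integral_cpow_mul_exp_mul_tricomiIntegral (α := 1 - z) (β := 0) (γ := 2)
    (by simpa using hz) (by norm_num) (by simp; linarith)
  rw [show (2 : ℂ) = 1 + 1 by norm_num, Complex.Gamma_add_one _ one_ne_zero, Complex.Gamma_one,
    mul_one, one_mul, show 1 - z - 1 = -z by ring, show (0 : ℂ) - (1 + 1) = -2 by norm_num] at h
  rw [← h, Complex.Gamma_eq_integral (s := 1 + z) (by simp; linarith), Complex.GammaIntegral,
    ← integral_const_mul]
  refine setIntegral_congr_fun measurableSet_Ioi fun u hu => ?_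
  have hu : 0 < u := hu
  have huc : (u : ℂ) ≠ 0 := by exact_mod_cast hu.ne'
  have hT : tricomiIntegral (1 - z) 0 u = (u : ℂ) ^ (z - 1) * Complex.Gamma (1 - z) := by
    have e := Complex.integral_cpow_mul_exp_neg_mul_Ioi (a := 1 - z) (by simpa using hz) hu
    simp only [tricomiIntegral, tricomiKernel, Complex.cpow_zero, mul_one]
    rw [e, one_div, Complex.inv_cpow _ _ (by
            rw [Complex.arg_ofReal_of_nonneg hu.le]; exact Real.pi_pos.ne),
            ← Complex.cpow_neg, neg_sub]
  simp only [hT, add_sub_cancel_left]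
  rw [Complex.cpow_one, Complex.cpow_sub _ _ huc, Complex.cpow_one]
  push_cast
  field_simp

/-! ### Parameters, and the decaying solution built from Tricomi's integral. -/

/-- The standing assumptions on `z`, `w` in the form in which they are used. -/
structure CoreParams (z w : ℂ) (a η : ℝ) : Prop where
  sum_eq : z + w = 2 * a
  abs_lt : |a| < 1 / 2
  -- The exponent η controls the singularity of A and B at 0: they are O(x^{-η}), hence square
  -- integrable there as η < 1/2. Strictness avoids the borderline z = w, where logarithms occur.
  abs_sub_lt : |z.re - a| < η
  eta_lt : η < 1 / 2
  z_ne : z ≠ 0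
  w_ne : w ≠ 0

namespace CoreParams

variable {z w : ℂ} {a η : ℝ}

/-- The symmetry exchanging the indices + and -, which preserves t = zw. -/
theorem neg (h : CoreParams z w a η) : CoreParams (-z) (-w) (-a) η where
  sum_eq := by rw [← neg_add, h.sum_eq]; push_cast; ring
  abs_lt := by rw [abs_neg]; exact h.abs_lt
  abs_sub_lt := by
    rw [show (-z).re - -a = -(z.re - a) by simp; ring, abs_neg]
    exact h.abs_sub_lt
  eta_lt := h.eta_lt
  z_ne := neg_ne_zero.2 h.z_ne
  w_ne := neg_ne_zero.2 h.w_ne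

theorem re_add (h : CoreParams z w a η) : z.re + w.re = 2 * a := by
  have := congrArg Complex.re h.sum_eq
  simpa using this

theorem swap (h : CoreParams z w a η) : CoreParams w z a η where
  sum_eq := by rw [add_comm, h.sum_eq]
  abs_lt := h.abs_lt
  abs_sub_lt := by
    rw [show w.re - a = -(z.re - a) by linarith [h.re_add], abs_neg]
    exact h.abs_sub_lt
  eta_lt := h.eta_lt
  z_ne := h.w_ne
  w_ne := h.z_ne

theorem re_lt (h : CoreParams z w a η) : z.re < a + η := by
  have := (_root_.abs_lt.1 h.abs_sub_lt).2
  linarith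

theorem add_lt_one (h : CoreParams z w a η) : a + η < 1 := by
  have := (_root_.abs_lt.1 h.abs_lt).2
  linarith [h.eta_lt]

theorem re_lt_one (h : CoreParams z w a η) : z.re < 1 := h.re_lt.trans h.add_lt_one

theorem neg_one_lt_re (h : CoreParams z w a η) : -1 < z.re := by
  have := h.neg.re_lt_one
  simp at this
  linarith

end CoreParams

/-- A decaying solution of the Whittaker system, with normalisations and bounds. -/
structure WhittakerPair (a η : ℝ) (t : ℂ) (p q : ℝ → ℂ) : Prop extends
    WhittakerSystem a t p q where
  tendsto_p : Tendsto p atTop (𝓝 1)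
  tendsto_q : Tendsto (fun x : ℝ => x * q x) atTop (𝓝 1)
  bound : ∃ C : ℝ, 0 ≤ C ∧ ∀ x : ℝ, 0 < x → ‖p x‖ ≤ C * (1 + x) * x ^ (-(a + η)) ∧
    ‖q x‖ ≤ C * x ^ (-(a + η)) ∧ ‖q x‖ ≤ C / x

/-- `x ^ (-1) ₂F₀(1 - z, 1 - w; ; -1 / x)`. -/
def tricomiQ (z w : ℂ) (x : ℝ) : ℂ :=
  (x : ℂ) ^ (-z) / Complex.Gamma (1 - z) * tricomiIntegral (1 - z) (w - 1) x

/-- `₂F₀(-z, -w; ; -1 / x)`. -/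
def tricomiP (z w : ℂ) (x : ℝ) : ℂ :=
  (x : ℂ) ^ (-z) / Complex.Gamma (1 - z) *
    ((x - w) * tricomiIntegral (1 - z) (w - 1) x + x * tricomiIntegral (1 - z + 1) (w - 1) x)

/-- `tricomiP` is built as (x-2a)q - xq' with q = `tricomiQ`, so the second equation is a
differentiation; the first is the contiguous relation `tricomiIntegral_recurrence`. -/
theorem CoreParams.whittakerSystem {z w : ℂ} {a η : ℝ} (h : CoreParams z w a η) :
    WhittakerSystem a (z * w) (tricomiP z w) (tricomiQ z w) := by
  have hα : 0 < (1 - z).re := by simpa using h.re_lt_one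
  have hβ : (w - 1).re ≤ 0 := by simpa using h.swap.re_lt_one.le
  have hα1 : 0 < (1 - z + 1).re := by rw [Complex.add_re, Complex.one_re]; linarith
  have h2a : (2 * a : ℂ) = z + w := h.sum_eq.symm
  refine ⟨fun x hx => ?_, fun x hx => ?_⟩
  · have hxc : (x : ℂ) ≠ 0 := by exact_mod_cast hx.ne'
    have hid : HasDerivAt (fun y : ℝ => (y : ℂ)) 1 x := (hasDerivAt_id x).ofReal_comp
    have d0 := hasDerivAt_tricomiIntegral hα hβ hx
    have d1 := hasDerivAt_tricomiIntegral hα1 hβ hx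
    have dz := (hasDerivAt_ofReal_cpow (neg_ne_zero.2 h.z_ne) hx).div_const (Complex.Gamma (1 - z))
    refine (dz.mul (((hid.sub_const w).mul d0).add (hid.mul d1))).congr_deriv ?_
    have r := tricomiIntegral_recurrence hα hβ hx
    rw [show 1 - z + 2 = 1 - z + 1 + 1 by ring] at r
    simp only [Pi.add_apply, Pi.mul_apply, tricomiQ]
    rw [eq_div_iff hxc]
    field_simp
    linear_combination -(x : ℂ) * (x : ℂ) ^ (-z) * (Complex.Gamma (1 - z))⁻¹ * r
  · have hxc : (x : ℂ) ≠ 0 := by exact_mod_cast hx.ne'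
    have d0 := hasDerivAt_tricomiIntegral hα hβ hx
    have dz := (hasDerivAt_ofReal_cpow (neg_ne_zero.2 h.z_ne) hx).div_const (Complex.Gamma (1 - z))
    refine (dz.mul d0).congr_deriv ?_
    rw [h2a]
    simp only [tricomiQ, tricomiP]
    field_simp
    ring

theorem norm_cpow_mul_tricomiIntegral_le {z w : ℂ} {ν : ℝ} (n : ℕ) (hν : 0 ≤ ν)
    (hw : ν ≤ 1 - w.re) (hz : ν < 1 - z.re + n) {x : ℝ} (hx : 0 < x) :
    ‖(x : ℂ) ^ (-z) * tricomiIntegral (1 - z + n) (w - 1) x‖ ≤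
      Real.Gamma (1 - z.re + n - ν) * (x ^ (ν - 1) / x ^ n) := by
  have h := norm_tricomiIntegral_le (α := 1 - z + n) (β := w - 1) hν (by simpa using hw)
    (by simpa using hz) hx
  rw [norm_mul, norm_ofReal_cpow hx]
  refine (mul_le_mul_of_nonneg_left h (by positivity)).trans_eq ?_
  simp only [Complex.add_re, Complex.sub_re, Complex.one_re, Complex.natCast_re, Complex.neg_re]
  rw [mul_left_comm, ← Real.rpow_add hx, ← Real.rpow_natCast, ← Real.rpow_sub hx]
  congr 2
  ring

theorem CoreParams.whittakerPair {z w : ℂ} {a η : ℝ} (h : CoreParams z w a η) :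
    WhittakerPair a η (z * w) (tricomiP z w) (tricomiQ z w) := by
  have hα : 0 < (1 - z).re := by simpa using h.re_lt_one
  have hβ : (w - 1).re ≤ 0 := by simpa using h.swap.re_lt_one.le
  have hz := h.re_lt
  have hw := h.swap.re_lt
  have h1 := h.add_lt_one
  have hΓ : Complex.Gamma (1 - z) ≠ 0 := Complex.Gamma_ne_zero_of_re_pos hα
  have hq : ∀ x : ℝ, tricomiQ z w x = (Complex.Gamma (1 - z))⁻¹ *
      ((x : ℂ) ^ (-z) * tricomiIntegral (1 - z) (w - 1) x) := fun x => by
    rw [tricomiQ]; ring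
  have hp : ∀ x : ℝ, tricomiP z w x = (x - w) * tricomiQ z w x + (Complex.Gamma (1 - z))⁻¹ *
      (x * ((x : ℂ) ^ (-z) * tricomiIntegral (1 - z + 1) (w - 1) x)) := fun x => by
    rw [tricomiP, tricomiQ]; ring
  have htq : Tendsto (fun x : ℝ => x * tricomiQ z w x) atTop (𝓝 1) := by
    have := (tendsto_cpow_mul_tricomiIntegral hα hβ).const_mul (Complex.Gamma (1 - z))⁻¹
    rw [inv_mul_cancel₀ hΓ] at this
    refine this.congr' ?_
    filter_upwards [eventually_gt_atTop 0] with x hx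
    have hxc : (x : ℂ) ≠ 0 := by exact_mod_cast hx.ne'
    rw [hq, show 1 - z = 1 + -z by ring, Complex.cpow_add _ _ hxc, Complex.cpow_one]
    ring
  have bq : ∀ ν : ℝ, 0 ≤ ν → ν ≤ 1 - w.re → ν < 1 - z.re → ∀ x : ℝ, 0 < x → ‖tricomiQ z w x‖ ≤
      ‖(Complex.Gamma (1 - z))⁻¹‖ * Real.Gamma (1 - z.re - ν) * x ^ (ν - 1) := by
    intro ν h0 h1 h2 x hx
    have := norm_cpow_mul_tricomiIntegral_le (z := z) 0 h0 h1 (by simpa using h2) hx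
    simp only [Nat.cast_zero, add_zero, pow_zero, div_one] at this
    rw [hq, norm_mul, mul_assoc]
    gcongr
  have b1 : ∀ ν : ℝ, 0 ≤ ν → ν ≤ 1 - w.re → ν < 2 - z.re → ∀ x : ℝ, 0 < x →
      ‖x * ((x : ℂ) ^ (-z) * tricomiIntegral (1 - z + 1) (w - 1) x)‖ ≤
      Real.Gamma (2 - z.re - ν) * x ^ (ν - 1) := by
    intro ν h0 h1 h2 x hx
    have := norm_cpow_mul_tricomiIntegral_le (z := z) 1 h0 h1 (by push_cast; linarith) hx
    simp only [Nat.cast_one, pow_one] at this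
    rw [norm_mul, Complex.norm_of_nonneg hx.le]
    calc _ ≤ x * (Real.Gamma (1 - z.re + 1 - ν) * (x ^ (ν - 1) / x)) := by gcongr
      _ = _ := by
        rw [show 1 - z.re + 1 - ν = 2 - z.re - ν by ring]
        field_simp
  refine { h.whittakerSystem with tendsto_p := ?_, tendsto_q := htq, bound := ?_ }
  · have t1 : Tendsto (fun x : ℝ => (x - w) * tricomiQ z w x) atTop (𝓝 1) := by
      have i : Tendsto (fun x : ℝ => (1 - w * ((x⁻¹ : ℝ) : ℂ)) * (x * tricomiQ z w x)) atTop
          (𝓝 ((1 - w * ((0 : ℝ) : ℂ)) * 1)) :=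
        (((Complex.continuous_ofReal.tendsto _).comp tendsto_inv_atTop_zero).const_mul w
          |>.const_sub 1).mul htq
      simp only [Complex.ofReal_zero, mul_zero, sub_zero, mul_one] at i
      refine i.congr' ?_
      filter_upwards [eventually_gt_atTop 0] with x hx
      have hxc : (x : ℂ) ≠ 0 := by exact_mod_cast hx.ne'
      push_cast
      field_simp
    have t2 : Tendsto (fun x : ℝ => x * ((x : ℂ) ^ (-z) *
        tricomiIntegral (1 - z + 1) (w - 1) x)) atTop (𝓝 0) := by
      refine squeeze_zero_norm' (a := fun x : ℝ => Real.Gamma (2 - z.re - 0) * x⁻¹) ?_ ?_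
      · filter_upwards [eventually_gt_atTop 0] with x hx
        have := b1 0 le_rfl (by linarith) (by linarith) x hx
        rwa [zero_sub, Real.rpow_neg_one] at this
      · simpa using tendsto_inv_atTop_zero.const_mul (Real.Gamma (2 - z.re - 0))
    have := t1.add (t2.const_mul (Complex.Gamma (1 - z))⁻¹)
    rw [mul_zero, add_zero] at this
    exact this.congr fun x => (hp x).symm
  · set g := ‖(Complex.Gamma (1 - z))⁻¹‖ with hg
    set A := g * Real.Gamma (1 - z.re - (1 - (a + η))) with hA
    set B := g * Real.Gamma (2 - z.re - (1 - (a + η))) with hB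
    set E := g * Real.Gamma (1 - z.re - 0) with hE
    have hg0 : 0 ≤ g := norm_nonneg _
    have hA0 : 0 ≤ A := mul_nonneg hg0 (Real.Gamma_pos_of_pos (by linarith)).le
    have hB0 : 0 ≤ B := mul_nonneg hg0 (Real.Gamma_pos_of_pos (by linarith)).le
    have hE0 : 0 ≤ E := mul_nonneg hg0 (Real.Gamma_pos_of_pos (by linarith)).le
    have hexp : 1 - (a + η) - 1 = -(a + η) := by ring
    refine ⟨(1 + ‖w‖) * A + B + E, by positivity, fun x hx => ?_⟩
    -- The exponent ν = 1 - (a+η) is allowed because Re z and Re w are below a+η < 1, and yields the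
    -- singularity x^{-(a+η)}; ν = 0 yields the decay 1/x.
    have q1 := bq (1 - (a + η)) (by linarith) (by linarith) (by linarith) x hx
    have q2 := bq 0 le_rfl (by linarith) (by linarith) x hx
    have p1 := b1 (1 - (a + η)) (by linarith) (by linarith) (by linarith) x hx
    rw [hexp] at q1 p1
    rw [zero_sub, Real.rpow_neg_one] at q2
    have hX : 0 < x ^ (-(a + η)) := by positivity
    set Xp := x ^ (-(a + η)) with hXp
    refine ⟨?_, ?_, ?_⟩
    · rw [hp]
      have n1 : ‖(x : ℂ) - w‖ ≤ (1 + ‖w‖) * (1 + x) := by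
        calc ‖(x : ℂ) - w‖ ≤ ‖(x : ℂ)‖ + ‖w‖ := norm_sub_le _ _
          _ = x + ‖w‖ := by rw [Complex.norm_of_nonneg hx.le]
          _ ≤ _ := by nlinarith [norm_nonneg w]
      calc _ ≤ ‖(x : ℂ) - w‖ * ‖tricomiQ z w x‖ + g * ‖x * ((x : ℂ) ^ (-z) *
            tricomiIntegral (1 - z + 1) (w - 1) x)‖ := by
            refine (norm_add_le _ _).trans ?_
            rw [norm_mul, norm_mul]
        _ ≤ ((1 + ‖w‖) * (1 + x)) * (A * Xp) +
            g * (Real.Gamma (2 - z.re - (1 - (a + η))) * Xp) := by gcongr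
        _ = ((1 + ‖w‖) * A * (1 + x) + B * 1) * Xp := by rw [hB]; ring
        _ ≤ ((1 + ‖w‖) * A * (1 + x) + B * (1 + x) + E * (1 + x)) * Xp := by
            refine mul_le_mul_of_nonneg_right ?_ hX.le
            have : 0 ≤ E * (1 + x) := by positivity
            have : B * 1 ≤ B * (1 + x) := mul_le_mul_of_nonneg_left (by linarith) hB0
            linarith
        _ = _ := by ring
    · refine q1.trans ?_
      gcongr
      nlinarith [mul_nonneg (norm_nonneg w) hA0]
    · refine q2.trans ?_
      rw [← div_eq_mul_inv]
      gcongr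
      have : 0 ≤ (1 + ‖w‖) * A := by positivity
      linarith

theorem weight_sq (a : ℝ) {x : ℝ} (hx : 0 < x) :
    weight a x ^ 2 = x ^ (2 * a) * Real.exp (-x) := by
  rw [weight, mul_pow, ← Real.rpow_natCast, ← Real.rpow_mul hx.le, ← Real.exp_nat_mul]
  congr 2
  · push_cast; ring
  · push_cast; ring

/-- Since the squared weight is u^{z+w} e^{-u}, the factor u^{-z} of `tricomiQ` cancels and a Mellin
transform at γ = 1+w remains. Its exponent (w-1) - (1+w) = -2 leads to the Beta integral above. -/
theorem CoreParams.integral_weight_sq_mul_tricomiQ {z w : ℂ} {a η : ℝ} (h : CoreParams z w a η) :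
    ∫ u : ℝ in Set.Ioi 0, (weight a u : ℂ) ^ 2 * tricomiQ z w u =
      Complex.Gamma (1 + z) * Complex.Gamma (1 + w) := by
  have hα : 0 < (1 - z).re := by simpa using h.re_lt_one
  have hw : 0 < (1 + w).re := by have := h.swap.neg_one_lt_re; simp; linarith
  have hΓ : Complex.Gamma (1 - z) ≠ 0 := Complex.Gamma_ne_zero_of_re_pos hα
  have k := integral_cpow_mul_exp_mul_tricomiIntegral (α := 1 - z) (β := w - 1) (γ := 1 + w)
    hα hw (by have := h.neg_one_lt_re; simp; linarith)
  rw [show w - 1 - (1 + w) = -2 by ring, show 1 - z - 1 = -z by ring, add_sub_cancel_left,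
    integral_cpow_mul_one_add_cpow_neg_two h.re_lt_one h.neg_one_lt_re] at k
  calc _ = ∫ u : ℝ in Set.Ioi 0, (Complex.Gamma (1 - z))⁻¹ *
        ((u : ℂ) ^ w * Complex.exp (-u) * tricomiIntegral (1 - z) (w - 1) u) := by
        refine setIntegral_congr_fun measurableSet_Ioi fun u hu => ?_
        have hu : 0 < u := hu
        have huc : (u : ℂ) ≠ 0 := by exact_mod_cast hu.ne'
        have e : (weight a u : ℂ) ^ 2 = (u : ℂ) ^ z * (u : ℂ) ^ w * Complex.exp (-u) := by
          rw [← Complex.ofReal_pow, weight_sq a hu, ← Complex.cpow_add _ _ huc, h.sum_eq]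
          push_cast
          rw [Complex.ofReal_cpow hu.le]
          push_cast
          rfl
        simp only [e, tricomiQ]
        rw [Complex.cpow_neg]
        have : (u : ℂ) ^ z ≠ 0 := by rw [Complex.cpow_ne_zero_iff]; exact Or.inl huc
        field_simp
    _ = _ := by
        rw [integral_const_mul, k]
        field_simp

/-! ### Stieltjes transforms of the decaying solutions. -/

/-- Continuity on the half-line, with an integrable power singularity at `0` and exponential decay
at infinity. -/
structure Tame (f : ℝ → ℂ) : Prop where
  continuousOn : ContinuousOn f (Set.Ioi 0)
  bound : ∃ C s : ℝ, s < 1 ∧ ∀ u : ℝ, 0 < u → ‖f u‖ ≤ C * (u ^ (-s) * Real.exp (-u / 2))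

namespace Tame

variable {f : ℝ → ℂ}

theorem integrableOn (h : Tame f) : IntegrableOn f (Set.Ioi 0) := by
  obtain ⟨C, s, hs, hb⟩ := h.bound
  refine ((integrableOn_rpow_mul_exp_neg (s := 1 - s) (x := 1 / 2) (by linarith)
    (by norm_num)).const_mul C).mono' (h.continuousOn.aestronglyMeasurable measurableSet_Ioi) ?_
  filter_upwards [ae_restrict_mem measurableSet_Ioi] with u hu
  refine (hb u hu).trans_eq ?_
  congr 3
  · ring
  · ring

theorem tendsto_mul_zero (h : Tame f) : Tendsto (fun u : ℝ => (u : ℂ) * f u) (𝓝[>] 0) (𝓝 0) := by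
  obtain ⟨C, s, hs, hb⟩ := h.bound
  refine squeeze_zero_norm' (a := fun u : ℝ => |C| * u ^ (1 - s)) ?_ ?_
  · filter_upwards [self_mem_nhdsWithin] with u hu
    have hu : 0 < u := hu
    rw [norm_mul, Complex.norm_of_nonneg hu.le]
    calc u * ‖f u‖ ≤ u * (|C| * (u ^ (-s) * 1)) := by
          gcongr
          refine (hb u hu).trans ?_
          gcongr
          · exact le_abs_self C
          · exact Real.exp_le_one_iff.2 (by linarith)
      _ = |C| * u ^ (1 - s) := by
          rw [sub_eq_add_neg, Real.rpow_add hu, Real.rpow_one]; ring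
  · have : Tendsto (fun u : ℝ => |C| * u ^ (1 - s)) (𝓝 0) (𝓝 (|C| * (0 : ℝ) ^ (1 - s))) :=
      (Real.continuousAt_rpow_const 0 (1 - s) (Or.inr (by linarith))).const_mul _
    rw [Real.zero_rpow (by linarith), mul_zero] at this
    exact this.mono_left nhdsWithin_le_nhds

theorem tendsto_mul_atTop (h : Tame f) : Tendsto (fun u : ℝ => (u : ℂ) * f u) atTop (𝓝 0) := by
  obtain ⟨C, s, hs, hb⟩ := h.bound
  refine squeeze_zero_norm' (a := fun u : ℝ => C * (u ^ (1 - s) * Real.exp (-u / 2))) ?_ ?_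
  · filter_upwards [eventually_gt_atTop 0] with u hu
    rw [norm_mul, Complex.norm_of_nonneg hu.le]
    calc u * ‖f u‖ ≤ u * (C * (u ^ (-s) * Real.exp (-u / 2))) := by
          gcongr
          exact hb u hu
      _ = _ := by
          rw [sub_eq_add_neg 1 s, Real.rpow_add hu, Real.rpow_one]; ring
  · simpa using (tendsto_rpow_mul_exp_neg_div_two (1 - s)).const_mul C

theorem tendsto_atTop (h : Tame f) : Tendsto f atTop (𝓝 0) := by
  have := (Complex.continuous_ofReal.tendsto _).comp tendsto_inv_atTop_zero |>.mul
    h.tendsto_mul_atTop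
  simp only [Complex.ofReal_zero, zero_mul] at this
  refine this.congr' ?_
  filter_upwards [eventually_gt_atTop 0] with u hu
  have huc : (u : ℂ) ≠ 0 := by exact_mod_cast hu.ne'
  simp only [Function.comp_apply, Complex.ofReal_inv]
  field_simp

theorem norm_div_add_le {u y δ : ℝ} (hu : 0 < u) (hδ : 0 < δ) (hy : δ ≤ y) (n : ℕ) (c : ℂ) :
    ‖c / ((u : ℂ) + y) ^ n‖ ≤ ‖c‖ / δ ^ n := by
  rw [norm_div, norm_pow, ← Complex.ofReal_add, Complex.norm_of_nonneg (by linarith)]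
  gcongr
  linarith

theorem aestronglyMeasurable_div_add (h : Tame f) {y : ℝ} (hy : 0 < y) (n : ℕ) :
    AEStronglyMeasurable (fun u : ℝ => f u / ((u : ℂ) + y) ^ n) (volume.restrict (Set.Ioi 0)) := by
  refine (h.continuousOn.div (by fun_prop) fun u hu => ?_).aestronglyMeasurable measurableSet_Ioi
  have hu : 0 < u := hu
  exact pow_ne_zero n (by exact_mod_cast (by linarith : u + y ≠ 0))

theorem integrableOn_div_add_pow (h : Tame f) {y : ℝ} (hy : 0 < y) (n : ℕ) :
    IntegrableOn (fun u : ℝ => f u / ((u : ℂ) + y) ^ n) (Set.Ioi 0) := by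
  refine (h.integrableOn.norm.div_const (y ^ n)).mono' (h.aestronglyMeasurable_div_add hy n) ?_
  filter_upwards [ae_restrict_mem measurableSet_Ioi] with u hu
  exact norm_div_add_le hu hy le_rfl n _

theorem integrableOn_div_add (h : Tame f) {y : ℝ} (hy : 0 < y) :
    IntegrableOn (fun u : ℝ => f u / ((u : ℂ) + y)) (Set.Ioi 0) := by
  simpa using h.integrableOn_div_add_pow hy 1

/-- The Stieltjes transform intertwines the Euler operators `u ∂ᵤ` and `y ∂_y`. -/
theorem hasDerivAt_stieltjes (h : Tame f) {e : ℝ → ℂ} (he : Tame e)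
    (hd : ∀ u : ℝ, 0 < u → HasDerivAt f (e u / u) u) {y : ℝ} (hy : 0 < y) :
    HasDerivAt (fun y : ℝ => ∫ u in Set.Ioi 0, f u / ((u : ℂ) + y))
      ((∫ u in Set.Ioi 0, e u / ((u : ℂ) + y)) / y) y := by
  have hyc : (y : ℂ) ≠ 0 := by exact_mod_cast hy.ne'
  have key := hasDerivAt_integral_of_dominated_loc_of_deriv_le (μ := volume.restrict (Set.Ioi 0))
    (F := fun (y u : ℝ) => f u / ((u : ℂ) + y)) (F' := fun (y u : ℝ) => -(f u / ((u : ℂ) + y) ^ 2))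
    (x₀ := y) (bound := fun u => ‖f u‖ / (y / 2) ^ 2) (s := Set.Ioi (y / 2))
    (Ioi_mem_nhds (half_lt_self hy)) ?_ (h.integrableOn_div_add hy)
    (h.aestronglyMeasurable_div_add hy 2).neg ?_ (h.integrableOn.norm.div_const _) ?_
  · refine key.2.congr_deriv ?_
    rw [eq_div_iff hyc, integral_neg]
    -- Integration by parts: the derivative of u f/(u+y) is y f/(u+y)² + u f'/(u+y), and u f' = e.
    have ibp := integral_Ioi_deriv_eq_zero (f := fun u : ℝ => (u : ℂ) * f u / ((u : ℂ) + y))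
      (f' := fun u : ℝ => y * (f u / ((u : ℂ) + y) ^ 2) + e u / ((u : ℂ) + y)) ?_ ?_ ?_ ?_
    · rw [integral_add ((h.integrableOn_div_add_pow hy 2).const_mul _)
        (he.integrableOn_div_add hy), integral_const_mul] at ibp
      linear_combination -ibp
    · intro u hu
      have huc : (u : ℂ) ≠ 0 := by exact_mod_cast hu.ne'
      have huy : (u : ℂ) + y ≠ 0 := by exact_mod_cast (by linarith : u + y ≠ 0)
      have hid : HasDerivAt (fun y : ℝ => (y : ℂ)) 1 u := (hasDerivAt_id u).ofReal_comp
      refine ((hid.mul (hd u hu)).div (hid.add_const (y : ℂ)) huy).congr_deriv ?_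
      simp only [Pi.mul_apply]
      field_simp
      ring
    · exact ((h.integrableOn_div_add_pow hy 2).const_mul _).add (he.integrableOn_div_add hy)
    · refine squeeze_zero_norm' (a := fun u : ℝ => ‖(u : ℂ) * f u‖ / y ^ 1) ?_ ?_
      · filter_upwards [self_mem_nhdsWithin] with u hu
        simpa using norm_div_add_le hu hy le_rfl 1 ((u : ℂ) * f u)
      · have := h.tendsto_mul_zero.norm.div_const (y ^ 1)
        rwa [norm_zero, zero_div] at this
    · refine squeeze_zero_norm' (a := fun u : ℝ => ‖(u : ℂ) * f u‖ / y ^ 1) ?_ ?_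
      · filter_upwards [eventually_gt_atTop 0] with u hu
        simpa using norm_div_add_le hu hy le_rfl 1 ((u : ℂ) * f u)
      · have := h.tendsto_mul_atTop.norm.div_const (y ^ 1)
        rwa [norm_zero, zero_div] at this
  · filter_upwards [lt_mem_nhds hy] with v hv
    simpa using h.aestronglyMeasurable_div_add hv 1
  · filter_upwards [ae_restrict_mem measurableSet_Ioi] with u hu v hv
    rw [norm_neg]
    exact norm_div_add_le hu (half_pos hy) (le_of_lt hv) 2 _
  · filter_upwards [ae_restrict_mem measurableSet_Ioi] with u hu v hv
    have hu : 0 < u := hu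
    have hv : y / 2 < v := hv
    have huv : (u : ℂ) + v ≠ 0 := by exact_mod_cast (by linarith : u + v ≠ 0)
    have hid : HasDerivAt (fun y : ℝ => (u : ℂ) + y) 1 v := ((hasDerivAt_id v).ofReal_comp).const_add _
    refine ((hasDerivAt_const v (f u)).div hid huv).congr_deriv ?_
    field_simp
    ring

end Tame

theorem hasDerivAt_weight_sq (a : ℝ) {x : ℝ} (hx : 0 < x) :
    HasDerivAt (fun x => (weight a x : ℂ) ^ 2) ((2 * a - x) / x * (weight a x : ℂ) ^ 2) x := by
  have hxc : (x : ℂ) ≠ 0 := by exact_mod_cast hx.ne'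
  have h := ((hasDerivAt_weight a hx).pow 2).ofReal_comp
  have h2 : HasDerivAt (fun x => (weight a x : ℂ) ^ 2)
      ((((2 : ℕ) : ℝ) * weight a x ^ (2 - 1) * ((a / x - 1 / 2) * weight a x) : ℝ) : ℂ) x := by
    simpa only [Pi.pow_apply, Complex.ofReal_pow] using h
  refine h2.congr_deriv ?_
  push_cast
  field_simp

theorem continuousOn_weight (a : ℝ) : ContinuousOn (weight a) (Set.Ioi 0) := fun _ hx =>
  (hasDerivAt_weight a hx).continuousAt.continuousWithinAt

theorem one_add_sq_mul_exp_neg_le {u : ℝ} (hu : 0 < u) :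
    (1 + u) ^ 2 * Real.exp (-u) ≤ 8 * Real.exp (-u / 2) := by
  -- The constant 8 clears the quadratic Taylor coefficient: 8(1 + u/2 + u²/8) dominates (1+u)².
  have h := Real.quadratic_le_exp_of_nonneg (x := u / 2) (by positivity)
  have e : Real.exp (-u) = Real.exp (-u / 2) * Real.exp (-u / 2) := by
    rw [← Real.exp_add]; congr 1; ring
  have e2 : Real.exp (-u / 2) * Real.exp (u / 2) = 1 := by
    rw [← Real.exp_add, neg_div, neg_add_cancel, Real.exp_zero]
  have h2 : (1 + u) ^ 2 * Real.exp (-u / 2) ≤ 8 := by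
    calc (1 + u) ^ 2 * Real.exp (-u / 2) ≤ (8 * Real.exp (u / 2)) * Real.exp (-u / 2) := by
          gcongr
          nlinarith
      _ = 8 := by rw [mul_assoc, mul_comm (Real.exp (u / 2)), e2, mul_one]
  rw [e, ← mul_assoc]
  gcongr

/-- The squared weight contributes u^{2a}, which leaves u^{-(η-a)} at 0; the polynomial factor is
absorbed by half of the exponential. -/
theorem tame_weight_sq_mul {a η : ℝ} (h1 : η - a < 1) {f : ℝ → ℂ} (hf : ContinuousOn f (Set.Ioi 0))
    {C : ℝ} (hC : 0 ≤ C) (hb : ∀ x : ℝ, 0 < x → ‖f x‖ ≤ C * (1 + x) ^ 2 * x ^ (-(a + η))) :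
    Tame fun u => (weight a u : ℂ) ^ 2 * f u := by
  refine ⟨((Complex.continuous_ofReal.comp_continuousOn (continuousOn_weight a)).pow 2).mul hf,
    C * 8, η - a, h1, fun u hu => ?_⟩
  rw [norm_mul, norm_pow, Complex.norm_of_nonneg (weight_pos a hu).le, weight_sq a hu]
  calc _ ≤ u ^ (2 * a) * Real.exp (-u) * (C * (1 + u) ^ 2 * u ^ (-(a + η))) := by
        gcongr
        exact hb u hu
    _ = C * u ^ (-(η - a)) * ((1 + u) ^ 2 * Real.exp (-u)) := by
        rw [show -(η - a) = 2 * a + -(a + η) by ring, Real.rpow_add hu]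
        ring
    _ ≤ C * u ^ (-(η - a)) * (8 * Real.exp (-u / 2)) := by
        gcongr C * u ^ (-(η - a)) * ?_
        exact one_add_sq_mul_exp_neg_le hu
    _ = _ := by ring

namespace WhittakerPair

variable {a η : ℝ} {t : ℂ} {p q : ℝ → ℂ}

theorem continuousOn_p (h : WhittakerPair a η t p q) : ContinuousOn p (Set.Ioi 0) := fun x hx =>
  (h.deriv_p x hx).continuousAt.continuousWithinAt

theorem continuousOn_q (h : WhittakerPair a η t p q) : ContinuousOn q (Set.Ioi 0) := fun x hx =>
  (h.deriv_q x hx).continuousAt.continuousWithinAt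

theorem tame_p (h : WhittakerPair a η t p q) (h1 : η - a < 1) :
    Tame fun u => (weight a u : ℂ) ^ 2 * p u := by
  obtain ⟨C, hC, hb⟩ := h.bound
  refine tame_weight_sq_mul h1 h.continuousOn_p hC fun x hx => (hb x hx).1.trans ?_
  gcongr
  nlinarith

theorem tame_q (h : WhittakerPair a η t p q) (h1 : η - a < 1) :
    Tame fun u => (weight a u : ℂ) ^ 2 * q u := by
  obtain ⟨C, hC, hb⟩ := h.bound
  refine tame_weight_sq_mul h1 h.continuousOn_q hC fun x hx => (hb x hx).2.1.trans ?_
  gcongr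
  exact le_mul_of_one_le_right hC (by nlinarith)

theorem tame_euler_p (h : WhittakerPair a η t p q) (ha : |a| < 1 / 2) (h1 : η - a < 1) :
    Tame fun u => (weight a u : ℂ) ^ 2 * ((2 * a - u) * p u + t * q u) := by
  obtain ⟨C, hC, hb⟩ := h.bound
  refine tame_weight_sq_mul (C := C * (1 + ‖t‖)) h1 ((ContinuousOn.mul (by fun_prop)
    h.continuousOn_p).add (h.continuousOn_q.const_smul t)) (by positivity) fun x hx => ?_
  have n1 : ‖(2 * a - x : ℂ)‖ ≤ 1 + x := by
    have : (2 * a - x : ℂ) = ((2 * a - x : ℝ) : ℂ) := by push_cast; ring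
    rw [this, Complex.norm_real, Real.norm_eq_abs, _root_.abs_le]
    have := abs_lt.1 ha
    constructor <;> linarith
  set X := x ^ (-(a + η))
  have hX : 0 < X := by positivity
  calc _ ≤ ‖(2 * a - x : ℂ)‖ * ‖p x‖ + ‖t‖ * ‖q x‖ := by
        refine (norm_add_le _ _).trans ?_
        rw [norm_mul, norm_mul]
    _ ≤ (1 + x) * (C * (1 + x) * X) + ‖t‖ * (C * X) := by
        gcongr
        · exact (hb x hx).1
        · exact (hb x hx).2.1
    _ ≤ (1 + x) * (C * (1 + x) * X) + ‖t‖ * (C * X) * (1 + x) ^ 2 := by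
        refine add_le_add le_rfl ?_
        exact le_mul_of_one_le_right (by positivity) (by nlinarith)
    _ = _ := by ring

theorem hasDerivAt_weight_sq_mul_p (h : WhittakerPair a η t p q) {x : ℝ} (hx : 0 < x) :
    HasDerivAt (fun u => (weight a u : ℂ) ^ 2 * p u)
      ((weight a x : ℂ) ^ 2 * ((2 * a - x) * p x + t * q x) / x) x := by
  refine ((hasDerivAt_weight_sq a hx).mul (h.deriv_p x hx)).congr_deriv ?_
  have hxc : (x : ℂ) ≠ 0 := by exact_mod_cast hx.ne'
  field_simp

theorem hasDerivAt_weight_sq_mul_q (h : WhittakerPair a η t p q) {x : ℝ} (hx : 0 < x) :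
    HasDerivAt (fun u => (weight a u : ℂ) ^ 2 * q u)
      (-((weight a x : ℂ) ^ 2 * p x) / x) x := by
  refine ((hasDerivAt_weight_sq a hx).mul (h.deriv_q x hx)).congr_deriv ?_
  have hxc : (x : ℂ) ≠ 0 := by exact_mod_cast hx.ne'
  field_simp
  ring

/-- With G the squared weight times q and F that times p, (uG)' = G - F, and uG vanishes at both
ends. -/
theorem integral_p_eq_integral_q (h : WhittakerPair a η t p q) (h1 : η - a < 1) :
    ∫ u in Set.Ioi 0, (weight a u : ℂ) ^ 2 * p u = ∫ u in Set.Ioi 0, (weight a u : ℂ) ^ 2 * q u := by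
  have hp := h.tame_p h1
  have hq := h.tame_q h1
  have := integral_Ioi_deriv_eq_zero (f := fun u : ℝ => (u : ℂ) * ((weight a u : ℂ) ^ 2 * q u))
    (f' := fun u : ℝ => (weight a u : ℂ) ^ 2 * q u - (weight a u : ℂ) ^ 2 * p u) ?_
    (hq.integrableOn.sub hp.integrableOn) hq.tendsto_mul_zero hq.tendsto_mul_atTop
  · rw [integral_sub hq.integrableOn hp.integrableOn] at this
    exact (sub_eq_zero.1 this).symm
  · intro x hx
    have hxc : (x : ℂ) ≠ 0 := by exact_mod_cast hx.ne'
    have hid : HasDerivAt (fun y : ℝ => (y : ℂ)) 1 x := (hasDerivAt_id x).ofReal_comp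
    refine (hid.mul (h.hasDerivAt_weight_sq_mul_q hx)).congr_deriv ?_
    field_simp
    ring

/-- The decaying solutions with parameter `a` are Stieltjes transforms of those with `-a`. -/
theorem eq_stieltjes {p' q' : ℝ → ℂ} {μ m : ℂ} (h : WhittakerPair a η t p q)
    (h' : WhittakerPair (-a) η t p' q') (ha : |a| < 1 / 2) (h1 : η + a < 1) (ht : t ≠ 0)
    (hμ : t = a ^ 2 - μ ^ 2) (hm : ∫ u in Set.Ioi 0, (weight (-a) u : ℂ) ^ 2 * p' u = m)
    (hm0 : m ≠ 0) {y : ℝ} (hy : 0 < y) :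
    ∫ u in Set.Ioi 0, (weight (-a) u : ℂ) ^ 2 * p' u / ((u : ℂ) + y) = m * q y ∧
      t * ∫ u in Set.Ioi 0, (weight (-a) u : ℂ) ^ 2 * q' u / ((u : ℂ) + y) = m * (1 - p y) := by
  have tp := h'.tame_p (by linarith)
  have tq := h'.tame_q (by linarith)
  have te := h'.tame_euler_p (by rwa [abs_neg]) (by linarith)
  set F := fun u => (weight (-a) u : ℂ) ^ 2 * p' u with hF
  set G := fun u => (weight (-a) u : ℂ) ^ 2 * q' u with hG
  set SF : ℝ → ℂ := fun y => ∫ u in Set.Ioi 0, F u / ((u : ℂ) + y) with hSF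
  set SG : ℝ → ℂ := fun y => ∫ u in Set.Ioi 0, G u / ((u : ℂ) + y) with hSG
  -- In the transform of the Euler derivative of F, the coefficient splits as -2a - u = (x - 2a) -
  -- (u + x); the last term integrates to -m, which is what the summand 1 in the first function
  -- accounts for.
  have hsys : WhittakerSystem a t (fun y => 1 - t * m⁻¹ * SG y) (fun y => m⁻¹ * SF y) := by
    refine ⟨fun x hx => ?_, fun x hx => ?_⟩
    · have hxc : (x : ℂ) ≠ 0 := by exact_mod_cast hx.ne'
      have tnp : Tame fun u => -F u := ⟨tp.continuousOn.neg, by simpa using tp.bound⟩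
      have d := tq.hasDerivAt_stieltjes tnp (fun u hu => h'.hasDerivAt_weight_sq_mul_q hu) hx
      refine ((d.const_mul (t * m⁻¹)).const_sub 1).congr_deriv ?_
      have : ∫ u in Set.Ioi 0, -F u / ((u : ℂ) + x) = -SF x := by
        simp only [neg_div, integral_neg, hSF]
      rw [this]
      field_simp
    · have hxc : (x : ℂ) ≠ 0 := by exact_mod_cast hx.ne'
      have d := tp.hasDerivAt_stieltjes te (fun u hu => h'.hasDerivAt_weight_sq_mul_p hu) hx
      refine (d.const_mul m⁻¹).congr_deriv ?_
      have : ∫ u in Set.Ioi 0, (weight (-a) u : ℂ) ^ 2 * ((2 * (-a : ℝ) - u) * p' u + t * q' u) /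
          ((u : ℂ) + x) = t * SG x + (x - 2 * a) * SF x - m := by
        have ig := (tq.integrableOn_div_add hx).const_mul t
        have i_f := (tp.integrableOn_div_add hx).const_mul ((x : ℂ) - 2 * a)
        have e : ∫ u in Set.Ioi 0, (weight (-a) u : ℂ) ^ 2 * ((2 * (-a : ℝ) - u) * p' u + t * q' u) /
          ((u : ℂ) + x) = ∫ u in Set.Ioi 0, (t * (G u / ((u : ℂ) + x)) +
            (x - 2 * a) * (F u / ((u : ℂ) + x)) - F u) := by
          refine setIntegral_congr_fun measurableSet_Ioi fun u hu => ?_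
          have hu : 0 < u := hu
          have hux : (u : ℂ) + x ≠ 0 := by exact_mod_cast (by linarith : u + x ≠ 0)
          simp only [hF, hG]
          push_cast
          field_simp
          ring
        have iadd : IntegrableOn (fun u : ℝ => t * (G u / ((u : ℂ) + x)) +
            (x - 2 * a) * (F u / ((u : ℂ) + x))) (Set.Ioi 0) := ig.add i_f
        rw [e, integral_sub iadd tp.integrableOn, integral_add ig i_f, integral_const_mul,
          integral_const_mul, hm]
      rw [this]
      field_simp
      ring
  have hlim : Tendsto (fun y => 1 - t * m⁻¹ * SG y) atTop (𝓝 1) := by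
    have : Tendsto SG atTop (𝓝 0) := by
      refine squeeze_zero_norm' (a := fun y : ℝ => (∫ u in Set.Ioi 0, ‖G u‖) * y⁻¹) ?_ ?_
      · filter_upwards [eventually_gt_atTop 0] with x hx
        rw [← integral_mul_const]
        refine norm_integral_le_of_norm_le (tq.integrableOn.norm.mul_const _) ?_
        filter_upwards [ae_restrict_mem measurableSet_Ioi] with u hu
        simpa [div_eq_mul_inv] using Tame.norm_div_add_le hu hx le_rfl 1 (G u)
      · simpa using tendsto_inv_atTop_zero.const_mul (∫ u in Set.Ioi 0, ‖G u‖)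
    simpa using (this.const_mul (t * m⁻¹)).const_sub 1
  -- Both first components give the Whittaker function with κ = a + 1/2, so uniqueness applies.
  have hEq : ∀ x : ℝ, 0 < x → 1 - t * m⁻¹ * SG x = p x := by
    intro x hx
    have := (hsys.isWhittakerW_p hlim hμ).eqOn
      (h.toWhittakerSystem.isWhittakerW_p h.tendsto_p hμ) (Set.mem_Ioi.2 hx)
    exact mul_left_cancel₀ (by exact_mod_cast (weight_pos _ hx).ne') this
  have hyc : (y : ℂ) ≠ 0 := by exact_mod_cast hy.ne'
  -- The second component is t⁻¹ x times the derivative of the first; this uses t ≠ 0.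
  have hq : m⁻¹ * SF y = q y := by
    have d1 := hsys.deriv_p y hy
    have d2 := (h.deriv_p y hy).congr_of_eventuallyEq (f₁ := fun y => 1 - t * m⁻¹ * SG y) (by
      filter_upwards [lt_mem_nhds hy] with x hx using hEq x hx)
    have := d1.unique d2
    field_simp at this
    field_simp
    exact this
  constructor
  · rw [← hq]; field_simp; rfl
  · rw [← hEq y hy]; field_simp; simp only [hSG]; ring

/-! ### The singular integral of the Christoffel–Darboux quotient. -/

/-- The Euler operator in r acts alike on functions of r and of rv. All terms cancel except those
from the coefficients r and rv, which leave the factor 1 - v and so remove the denominator. -/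
theorem hasDerivAt_wronskian_scaled (h : WhittakerPair a η t p q) {v r : ℝ} (hv : 0 < v)
    (hv1 : v ≠ 1) (hr : 0 < r) :
    HasDerivAt (fun r : ℝ => (p r * ((weight a (r * v) : ℂ) ^ 2 * q (r * v)) -
      q r * ((weight a (r * v) : ℂ) ^ 2 * p (r * v))) / (1 - v))
      (-(q r * ((weight a (r * v) : ℂ) ^ 2 * p (r * v)))) r := by
  have hrv : 0 < r * v := mul_pos hr hv
  have hrc : (r : ℂ) ≠ 0 := by exact_mod_cast hr.ne'
  have hvc : (v : ℂ) ≠ 0 := by exact_mod_cast hv.ne'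
  have hv1c : (1 : ℂ) - v ≠ 0 := sub_ne_zero.2 (by exact_mod_cast hv1.symm)
  have hl : HasDerivAt (fun r : ℝ => r * v) v r := hasDerivAt_mul_const v
  have dp := HasDerivAt.scomp r (h.hasDerivAt_weight_sq_mul_p hrv) hl
  have dq := HasDerivAt.scomp r (h.hasDerivAt_weight_sq_mul_q hrv) hl
  refine ((((h.deriv_p r hr).mul dq).sub ((h.deriv_q r hr).mul dp)).div_const
    ((1 : ℂ) - v)).congr_deriv ?_
  simp only [Function.comp_apply, Complex.real_smul]
  push_cast
  field_simp
  ring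

theorem integrableOn_div (h : WhittakerPair a η t p q) {x : ℝ} (hx : 0 < x) :
    IntegrableOn (fun r : ℝ => q r / r) (Set.Ioi x) := by
  obtain ⟨C, hC, hb⟩ := h.bound
  refine ((integrableOn_Ioi_rpow_of_lt (a := -2) (by norm_num) hx).const_mul C).mono' ?_ ?_
  · refine ContinuousOn.aestronglyMeasurable ((h.continuousOn_q.mono
      (Set.Ioi_subset_Ioi hx.le)).div (by fun_prop) fun r hr => ?_) measurableSet_Ioi
    exact_mod_cast (hx.trans hr).ne'
  · filter_upwards [ae_restrict_mem measurableSet_Ioi] with r hr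
    have hr : 0 < r := hx.trans hr
    rw [norm_div, Complex.norm_of_nonneg hr.le, Real.rpow_neg hr.le]
    calc ‖q r‖ / r ≤ (C / r) / r := by gcongr; exact (hb r hr).2.2
      _ = _ := by norm_cast; field_simp

/-- The singular row integral of the Christoffel–Darboux type kernel. -/
theorem integral_wronskian_div_sub (h : WhittakerPair a η t p q) (h1 : η - a < 1) {m : ℂ}
    (hm : ∫ u in Set.Ioi 0, (weight a u : ℂ) ^ 2 * p u = m) {x : ℝ} (hx : 0 < x) :
    IntegrableOn (fun u : ℝ => (p x * ((weight a u : ℂ) ^ 2 * q u) -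
      q x * ((weight a u : ℂ) ^ 2 * p u)) / (x - u)) (Set.Ioi 0) ∧
    t * ∫ u in Set.Ioi 0, (p x * ((weight a u : ℂ) ^ 2 * q u) -
      q x * ((weight a u : ℂ) ^ 2 * p u)) / (x - u) = m * (1 - p x) := by
  have tp := h.tame_p h1
  have tq := h.tame_q h1
  have hxc : (x : ℂ) ≠ 0 := by exact_mod_cast hx.ne'
  set F := fun u => (weight a u : ℂ) ^ 2 * p u with hF
  set G := fun u => (weight a u : ℂ) ^ 2 * q u with hG
  set N : ℝ → ℂ := fun u => (p x * G u - q x * F u) / (x - u) with hN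
  have hFr : ∀ r : ℝ, 0 < r → IntegrableOn (fun v => F (r * v)) (Set.Ioi 0) := fun r hr => by
    rw [integrableOn_Ioi_comp_mul_left_iff F 0 hr, mul_zero]; exact tp.integrableOn
  have hFv : ∀ v : ℝ, 0 < v → IntegrableOn (fun r => F (r * v)) (Set.Ioi x) := fun v hv => by
    rw [integrableOn_Ioi_comp_mul_right_iff F x hv]
    exact tp.integrableOn.mono_set (Set.Ioi_subset_Ioi (mul_pos hx hv).le)
  obtain ⟨C, hC, hb⟩ := h.bound
  set K : ℝ → ℝ → ℂ := fun r v => q r * F (r * v) with hK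
  have hcont : ContinuousOn (Function.uncurry K) (Set.Ioi x ×ˢ Set.Ioi 0) := by
    refine (h.continuousOn_q.comp continuousOn_fst fun r hr => ?_).mul
      (tp.continuousOn.comp (f := fun r : ℝ × ℝ => r.1 * r.2) (by fun_prop) fun r hr => ?_)
    · exact hx.trans hr.1
    · exact mul_pos (hx.trans hr.1) hr.2
  have hint : Integrable (Function.uncurry K)
      ((volume.restrict (Set.Ioi x)).prod (volume.restrict (Set.Ioi 0))) := by
    have hmeas : AEStronglyMeasurable (Function.uncurry K)
        ((volume.restrict (Set.Ioi x)).prod (volume.restrict (Set.Ioi 0))) := by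
      rw [Measure.prod_restrict]
      exact hcont.aestronglyMeasurable (measurableSet_Ioi.prod measurableSet_Ioi)
    rw [integrable_prod_iff hmeas]
    constructor
    · filter_upwards [ae_restrict_mem measurableSet_Ioi] with r hr
      exact (hFr r (hx.trans hr)).const_mul (q r)
    · refine ((h.integrableOn_div hx).norm.mul_const (∫ u in Set.Ioi 0, ‖F u‖)).congr ?_
      filter_upwards [ae_restrict_mem measurableSet_Ioi] with r hr
      have hr : 0 < r := hx.trans hr
      simp only [Function.uncurry, hK, norm_mul]
      rw [integral_const_mul, integral_comp_mul_left_Ioi (fun u => ‖F u‖) 0 hr, mul_zero, norm_div,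
        Complex.norm_of_nonneg hr.le, smul_eq_mul]
      ring
  -- Integrating the derivative in r from x to infinity writes the quotient at u = xv as an integral
  -- of `K`, which has no singularity at v = 1.
  have hinner : ∀ v : ℝ, 0 < v → v ≠ 1 → ∫ r in Set.Ioi x, K r v = x * N (x * v) := by
    intro v hv hv1
    have hv1c : (1 : ℂ) - v ≠ 0 := sub_ne_zero.2 (by exact_mod_cast hv1.symm)
    have lim : Tendsto (fun r : ℝ => (p r * G (r * v) - q r * F (r * v)) / (1 - v)) atTop (𝓝 0) := by
      have hrv : Tendsto (fun r : ℝ => r * v) atTop atTop := tendsto_id.atTop_mul_const hv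
      have lq : Tendsto q atTop (𝓝 0) := by
        refine squeeze_zero_norm' (a := fun r : ℝ => C * r⁻¹) ?_ ?_
        · filter_upwards [eventually_gt_atTop 0] with r hr using (hb r hr).2.2
        · simpa using tendsto_inv_atTop_zero.const_mul C
      have := ((h.tendsto_p.mul (tq.tendsto_atTop.comp hrv)).sub
        (lq.mul (tp.tendsto_atTop.comp hrv))).div_const ((1 : ℂ) - v)
      simpa using this
    have hKv : IntegrableOn (fun r => K r v) (Set.Ioi x) := by
      refine ((hFv v hv).norm.const_mul (C / x)).mono' ?_ ?_
      · exact (hcont.comp (f := fun r : ℝ => (r, v)) (by fun_prop)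
          fun r hr => ⟨hr, hv⟩).aestronglyMeasurable measurableSet_Ioi
      · filter_upwards [ae_restrict_mem measurableSet_Ioi] with r hr
        have hr' : x < r := hr
        rw [hK, norm_mul]
        gcongr
        exact ((hb r (hx.trans hr)).2.2).trans (by gcongr)
    have := integral_Ioi_of_hasDerivAt_of_tendsto'
      (fun r hr => h.hasDerivAt_wronskian_scaled hv hv1 (hx.trans_le hr)) hKv.neg lim
    rw [integral_neg] at this
    have e : ∫ r in Set.Ioi x, K r v = (p x * G (x * v) - q x * F (x * v)) / (1 - v) := by
      linear_combination -this
    have hd : (x : ℂ) - (x * v : ℝ) = x * (1 - v) := by push_cast; ring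
    simp only [e, hN]
    rw [hd]
    field_simp
  have hae : (fun v => ∫ r in Set.Ioi x, K r v) =ᵐ[volume.restrict (Set.Ioi 0)]
      fun v => x * N (x * v) := by
    have h1 : ∀ᵐ v : ℝ ∂volume.restrict (Set.Ioi 0), v ≠ 1 :=
      ae_restrict_of_ae (by simp [ae_iff])
    filter_upwards [ae_restrict_mem measurableSet_Ioi, h1] with v hv hv1 using hinner v hv hv1
  -- Integrability across u = x is inherited from the Fubini integrability of `K`.
  have hNint : IntegrableOn N (Set.Ioi 0) := by
    have h2 : IntegrableOn (fun v => x * N (x * v)) (Set.Ioi 0) :=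
      (hint.integral_prod_right (f := Function.uncurry K)).congr hae
    have h3 := h2.const_mul ((x : ℂ)⁻¹)
    have h4 : IntegrableOn (fun v => N (x * v)) (Set.Ioi 0) := by
      refine h3.congr (Eventually.of_forall fun v => ?_)
      simp only
      field_simp
    rw [integrableOn_Ioi_comp_mul_left_iff N 0 hx, mul_zero] at h4
    exact h4
  refine ⟨hNint, ?_⟩
  have e1 : ∫ u in Set.Ioi 0, N u = ∫ v in Set.Ioi 0, ∫ r in Set.Ioi x, K r v := by
    rw [integral_congr_ae hae, integral_const_mul, integral_comp_mul_left_Ioi N 0 hx, mul_zero,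
      Complex.real_smul]
    push_cast
    field_simp
  have e2 : ∫ r in Set.Ioi x, t * (q r / r) = 1 - p x :=
    integral_Ioi_of_hasDerivAt_of_tendsto' (fun r hr =>
      (h.deriv_p r (hx.trans_le hr)).congr_deriv (by ring))
      ((h.integrableOn_div hx).const_mul t) h.tendsto_p
  -- After swapping, the integral of F(rv) over v is m/r, and m times the integral of t q/r = p'
  -- over (x, ∞) remains.
  rw [e1, ← integral_integral_swap hint, ← e2, integral_const_mul, mul_left_comm]
  congr 1
  rw [← integral_const_mul]
  refine setIntegral_congr_fun measurableSet_Ioi fun r hr => ?_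
  have hr : 0 < r := hx.trans hr
  simp only [hK]
  rw [integral_const_mul, integral_comp_mul_left_Ioi F 0 hr, mul_zero, hm, Complex.real_smul]
  push_cast
  field_simp

end WhittakerPair

/-! ### The two resolvent equations for the kernels. -/

/-- The kernel `s (x / y) ^ a exp (-(x + y) / 2) / (x + y)`. -/
def crossKernel (a s x y : ℝ) : ℝ := s * (weight a x * weight (-a) y / (x + y))

/-- The diagonal block of the matrix Whittaker kernel in terms of Tricomi functions. -/
def diagBlock (z w : ℂ) (a x y : ℝ) : ℂ :=
  1 / (Complex.Gamma z * Complex.Gamma w) * (weight a x * weight a y *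
    (tricomiP z w x * tricomiQ z w y - tricomiQ z w x * tricomiP z w y) / ((x : ℂ) - y))

/-- The off-diagonal block of the matrix Whittaker kernel in terms of Tricomi functions. -/
def crossBlock (z w : ℂ) (a s x y : ℝ) : ℂ :=
  s * (weight a x * weight (-a) y * (tricomiP z w x * tricomiP (-z) (-w) y +
    z * w * (tricomiQ z w x * tricomiQ (-z) (-w) y)) / ((x : ℂ) + y))

theorem memLp_two_of_norm_le {f : ℝ → ℂ} (hf : ContinuousOn f (Set.Ioi 0)) {C s : ℝ} (hs : s < 1 / 2)
    (hb : ∀ u : ℝ, 0 < u → ‖f u‖ ≤ C * (u ^ (-s) * ((1 + u) * Real.exp (-u / 2)))) :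
    MemLp f 2 halfLine := by
  have hm : AEStronglyMeasurable f halfLine := hf.aestronglyMeasurable measurableSet_Ioi
  rw [memLp_two_iff_integrable_sq_norm hm]
  refine ((integrableOn_rpow_mul_exp_neg (s := 1 - 2 * s) (x := 1 / 2) (by linarith)
    (by norm_num)).const_mul (C ^ 2 * 8)).mono' (hm.norm.pow 2) ?_
  filter_upwards [ae_restrict_mem measurableSet_Ioi] with u hu
  have hu : 0 < u := hu
  rw [Real.norm_of_nonneg (by positivity)]
  have h8 := one_add_sq_mul_exp_neg_le hu
  calc ‖f u‖ ^ 2 ≤ (C * (u ^ (-s) * ((1 + u) * Real.exp (-u / 2)))) ^ 2 := by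
        gcongr
        exact hb u hu
    _ = C ^ 2 * u ^ (-(2 * s)) * ((1 + u) ^ 2 * Real.exp (-u)) := by
        have e1 : u ^ (-(2 * s)) = (u ^ (-s)) ^ 2 := by
          rw [← Real.rpow_natCast, ← Real.rpow_mul hu.le]; congr 1; push_cast; ring
        have e2 : Real.exp (-u) = Real.exp (-u / 2) ^ 2 := by
          rw [← Real.exp_nat_mul]; congr 1; push_cast; ring
        rw [e1, e2]; ring
    _ ≤ C ^ 2 * u ^ (-(2 * s)) * (8 * Real.exp (-u / 2)) := by gcongr
    _ = _ := by
        rw [show (1 - 2 * s - 1) = -(2 * s) by ring, show -(1 / 2 * u) = -u / 2 by ring]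
        ring

theorem continuousOn_ofReal_weight (a : ℝ) :
    ContinuousOn (fun u => (weight a u : ℂ)) (Set.Ioi 0) :=
  Complex.continuous_ofReal.comp_continuousOn (continuousOn_weight a)

theorem norm_ofReal_weight (a : ℝ) {u : ℝ} (hu : 0 < u) :
    ‖(weight a u : ℂ)‖ = u ^ a * Real.exp (-u / 2) := by
  rw [Complex.norm_of_nonneg (weight_pos a hu).le, weight]

theorem WhittakerPair.memLp_p {a η : ℝ} {t : ℂ} {p q : ℝ → ℂ} (h : WhittakerPair a η t p q)
    (hη : η < 1 / 2) : MemLp (fun u => (weight a u : ℂ) * p u) 2 halfLine := by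
  obtain ⟨C, hC, hb⟩ := h.bound
  refine memLp_two_of_norm_le (C := C) ((continuousOn_ofReal_weight a).mul h.continuousOn_p) hη
    fun u hu => ?_
  rw [norm_mul, norm_ofReal_weight a hu]
  calc _ ≤ u ^ a * Real.exp (-u / 2) * (C * (1 + u) * u ^ (-(a + η))) := by
        gcongr; exact (hb u hu).1
    _ = _ := by
        rw [show -η = a + -(a + η) by ring, Real.rpow_add hu]; ring

theorem WhittakerPair.memLp_q {a η : ℝ} {t : ℂ} {p q : ℝ → ℂ} (h : WhittakerPair a η t p q)
    (hη : η < 1 / 2) : MemLp (fun u => (weight a u : ℂ) * q u) 2 halfLine := by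
  obtain ⟨C, hC, hb⟩ := h.bound
  refine memLp_two_of_norm_le (C := C) ((continuousOn_ofReal_weight a).mul h.continuousOn_q) hη
    fun u hu => ?_
  rw [norm_mul, norm_ofReal_weight a hu]
  calc _ ≤ u ^ a * Real.exp (-u / 2) * (C * u ^ (-(a + η))) := by
        gcongr; exact (hb u hu).2.1
    _ = C * (u ^ (-η) * (1 * Real.exp (-u / 2))) := by
        rw [show -η = a + -(a + η) by ring, Real.rpow_add hu]; ring
    _ ≤ _ := by gcongr; linarith

theorem MemLp.div_add {f : ℝ → ℂ} (hf : MemLp f 2 halfLine) {x : ℝ} (hx : 0 < x) :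
    MemLp (fun u : ℝ => f u / ((x : ℂ) + u)) 2 halfLine := by
  refine (hf.const_mul ((x⁻¹ : ℝ) : ℂ)).mono ?_ ?_
  · have : ContinuousOn (fun u : ℝ => ((x : ℂ) + u)⁻¹) (Set.Ioi 0) := by
      refine ContinuousOn.inv₀ (by fun_prop) fun u hu => ?_
      have hu : 0 < u := hu
      exact_mod_cast (by linarith : x + u ≠ 0)
    exact (hf.1.mul (this.aestronglyMeasurable measurableSet_Ioi)).congr
      (Eventually.of_forall fun u => (div_eq_mul_inv _ _).symm)
  · filter_upwards [ae_restrict_mem measurableSet_Ioi] with u hu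
    have hu : 0 < u := hu
    rw [norm_div, norm_mul, ← Complex.ofReal_add, Complex.norm_of_nonneg (by linarith),
      Complex.norm_of_nonneg (by positivity), div_eq_inv_mul]
    gcongr
    linarith

namespace CoreParams

variable {z w : ℂ} {a η s : ℝ}

theorem whittakerPair_neg (h : CoreParams z w a η) :
    WhittakerPair (-a) η (z * w) (tricomiP (-z) (-w)) (tricomiQ (-z) (-w)) := by
  have := h.neg.whittakerPair
  rwa [neg_mul_neg] at this

theorem memLp_crossBlock (h : CoreParams z w a η) {x : ℝ} (hx : 0 < x) :
    MemLp (crossBlock z w a s x) 2 halfLine := by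
  have hp := h.whittakerPair_neg.memLp_p h.eta_lt
  have hq := h.whittakerPair_neg.memLp_q h.eta_lt
  have := MemLp.div_add ((hp.const_mul (s * weight a x * tricomiP z w x)).add
    (hq.const_mul (s * weight a x * (z * w) * tricomiQ z w x))) hx
  refine (memLp_congr_ae (Eventually.of_forall fun u => ?_)).1 this
  simp only [crossBlock, Pi.add_apply]
  ring

theorem integral_weight_sq_mul_tricomiP (h : CoreParams z w a η) :
    ∫ u : ℝ in Set.Ioi 0, (weight a u : ℂ) ^ 2 * tricomiP z w u =
      Complex.Gamma (1 + z) * Complex.Gamma (1 + w) := by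
  rw [h.whittakerPair.integral_p_eq_integral_q (by linarith [h.neg.add_lt_one]),
    h.integral_weight_sq_mul_tricomiQ]

theorem gamma_mul_gamma_ne_zero (h : CoreParams z w a η) :
    Complex.Gamma (1 + z) * Complex.Gamma (1 + w) ≠ 0 :=
  mul_ne_zero
    (Complex.Gamma_ne_zero_of_re_pos (by
      rw [Complex.add_re, Complex.one_re]; linarith [h.neg_one_lt_re]))
    (Complex.Gamma_ne_zero_of_re_pos (by
      rw [Complex.add_re, Complex.one_re]; linarith [h.swap.neg_one_lt_re]))

theorem mul_eq_sq_sub_sq (h : CoreParams z w a η) : z * w = a ^ 2 - ((z - w) / 2) ^ 2 := by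
  have : (a : ℂ) = (z + w) / 2 := by rw [h.sum_eq]; ring
  rw [this]
  ring

theorem stieltjes (h : CoreParams z w a η) {y : ℝ} (hy : 0 < y) :
    ∫ u in Set.Ioi 0, (weight (-a) u : ℂ) ^ 2 * tricomiP (-z) (-w) u / ((u : ℂ) + y) =
      Complex.Gamma (1 - z) * Complex.Gamma (1 - w) * tricomiQ z w y ∧
    z * w * ∫ u in Set.Ioi 0, (weight (-a) u : ℂ) ^ 2 * tricomiQ (-z) (-w) u / ((u : ℂ) + y) =
      Complex.Gamma (1 - z) * Complex.Gamma (1 - w) * (1 - tricomiP z w y) :=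
  h.whittakerPair.eq_stieltjes h.whittakerPair_neg h.abs_lt (by linarith [h.add_lt_one])
    (mul_ne_zero h.z_ne h.w_ne) h.mul_eq_sq_sub_sq h.neg.integral_weight_sq_mul_tricomiP
    h.neg.gamma_mul_gamma_ne_zero hy

theorem one_div_gamma_mul_gamma (h : CoreParams z w a η) :
    1 / (Complex.Gamma z * Complex.Gamma w) =
      z * w / (Complex.Gamma (1 + z) * Complex.Gamma (1 + w)) := by
  rw [add_comm 1 z, add_comm 1 w, Complex.Gamma_add_one z h.z_ne, Complex.Gamma_add_one w h.w_ne]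
  have hz := h.z_ne
  have hw := h.w_ne
  field_simp

/-- By 1/((u+x)(u+y)) = (1/(u+y) - 1/(u+x))/(x-y) the integral becomes a difference of Stieltjes
transforms, which telescopes to p(x)q(y) - q(x)p(y). The hypothesis on s makes the constants agree.
-/
theorem diagBlock_eq_integral (h : CoreParams z w a η)
    (hs : (s : ℂ) ^ 2 * (Complex.Gamma (1 + z) * Complex.Gamma (1 + w) *
      (Complex.Gamma (1 - z) * Complex.Gamma (1 - w))) = z * w) {x y : ℝ} (hx : 0 < x) (hy : 0 < y)
    (hxy : x ≠ y) :
    ∫ u, (crossKernel a s y u : ℂ) * crossBlock z w a s x u ∂halfLine = diagBlock z w a x y := by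
  obtain ⟨Fx, Gx⟩ := h.stieltjes hx
  obtain ⟨Fy, Gy⟩ := h.stieltjes hy
  have tp := h.whittakerPair_neg.tame_p (by linarith [h.add_lt_one])
  have tq := h.whittakerPair_neg.tame_q (by linarith [h.add_lt_one])
  have hg := h.gamma_mul_gamma_ne_zero
  have hxyc : (x : ℂ) - y ≠ 0 := sub_ne_zero.2 (by exact_mod_cast hxy)
  have hk : z * w / (Complex.Gamma (1 + z) * Complex.Gamma (1 + w)) =
      s ^ 2 * (Complex.Gamma (1 - z) * Complex.Gamma (1 - w)) := by
    rw [div_eq_iff hg, ← hs]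
    ring
  have e : ∫ u, (crossKernel a s y u : ℂ) * crossBlock z w a s x u ∂halfLine =
      ∫ u in Set.Ioi 0, s ^ 2 * weight a x * weight a y / ((x : ℂ) - y) *
        (tricomiP z w x * ((weight (-a) u : ℂ) ^ 2 * tricomiP (-z) (-w) u / ((u : ℂ) + y) -
          (weight (-a) u : ℂ) ^ 2 * tricomiP (-z) (-w) u / ((u : ℂ) + x)) +
        z * w * tricomiQ z w x * ((weight (-a) u : ℂ) ^ 2 * tricomiQ (-z) (-w) u / ((u : ℂ) + y) -
          (weight (-a) u : ℂ) ^ 2 * tricomiQ (-z) (-w) u / ((u : ℂ) + x))) := by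
    refine setIntegral_congr_fun measurableSet_Ioi fun u hu => ?_
    have hu : 0 < u := hu
    have hux : (u : ℂ) + x ≠ 0 := by exact_mod_cast (by linarith : u + x ≠ 0)
    have huy : (u : ℂ) + y ≠ 0 := by exact_mod_cast (by linarith : u + y ≠ 0)
    simp only [crossKernel, crossBlock]
    push_cast
    rw [add_comm (x : ℂ) u, add_comm (y : ℂ) u]
    field_simp
    ring
  have pi := ((tp.integrableOn_div_add hy).sub (tp.integrableOn_div_add hx)).const_mul
    (tricomiP z w x)
  have qi := ((tq.integrableOn_div_add hy).sub (tq.integrableOn_div_add hx)).const_mul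
    (z * w * tricomiQ z w x)
  rw [e, integral_const_mul]
  have e2 := integral_add pi qi
  simp only [Pi.sub_apply] at e2
  rw [e2, integral_const_mul, integral_const_mul, integral_sub (tp.integrableOn_div_add hy)
    (tp.integrableOn_div_add hx), integral_sub (tq.integrableOn_div_add hy)
    (tq.integrableOn_div_add hx), Fx, Fy, diagBlock, h.one_div_gamma_mul_gamma, hk]
  linear_combination (s : ℂ) ^ 2 * weight a x * weight a y / ((x : ℂ) - y) * tricomiQ z w x *
    (Gy - Gx)

/-- Here 1/((x-u)(u+y)) = (1/(x-u) + 1/(u+y))/(x+y): the first part is the singular integral, the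
second the Stieltjes transforms with the roles of + and - exchanged. Everything cancels against the
cross block except the constant 1. -/
theorem crossBlock_add_integral (h : CoreParams z w a η) {x y : ℝ} (hx : 0 < x) (hy : 0 < y) :
    crossBlock z w a s x y + ∫ u, (crossKernel a s u y : ℂ) * diagBlock z w a x u ∂halfLine =
      crossKernel a s x y := by
  obtain ⟨Fy, Gy⟩ := h.neg.stieltjes hy
  simp only [neg_neg, neg_mul_neg, sub_neg_eq_add] at Fy Gy
  have h1 : η - a < 1 := by linarith [h.neg.add_lt_one]
  have tp := h.whittakerPair.tame_p h1
  have tq := h.whittakerPair.tame_q h1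
  obtain ⟨iN, hN⟩ := h.whittakerPair.integral_wronskian_div_sub h1
    h.integral_weight_sq_mul_tricomiP hx
  have hg := h.gamma_mul_gamma_ne_zero
  have hxy : (x : ℂ) + y ≠ 0 := by exact_mod_cast (by linarith : x + y ≠ 0)
  have hk := h.one_div_gamma_mul_gamma
  generalize Complex.Gamma (1 + z) * Complex.Gamma (1 + w) = m at Fy Gy hN hg hk
  have hmi : m * m⁻¹ = 1 := mul_inv_cancel₀ hg
  have e : ∫ u, (crossKernel a s u y : ℂ) * diagBlock z w a x u ∂halfLine =
      ∫ u in Set.Ioi 0, z * w / m * (s * weight a x * weight (-a) y / ((x : ℂ) + y)) *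
        ((tricomiP z w x * ((weight a u : ℂ) ^ 2 * tricomiQ z w u) -
          tricomiQ z w x * ((weight a u : ℂ) ^ 2 * tricomiP z w u)) / ((x : ℂ) - u) +
        (tricomiP z w x * ((weight a u : ℂ) ^ 2 * tricomiQ z w u / ((u : ℂ) + y)) -
          tricomiQ z w x * ((weight a u : ℂ) ^ 2 * tricomiP z w u / ((u : ℂ) + y)))) := by
    have hne : ∀ᵐ u : ℝ ∂volume.restrict (Set.Ioi 0), u ≠ x :=
      ae_restrict_of_ae (by simp [ae_iff])
    refine integral_congr_ae ?_
    filter_upwards [ae_restrict_mem measurableSet_Ioi, hne] with u hu hux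
    have hu : 0 < u := hu
    have hxu : (x : ℂ) - u ≠ 0 := sub_ne_zero.2 (by exact_mod_cast hux.symm)
    have huy : (u : ℂ) + y ≠ 0 := by exact_mod_cast (by linarith : u + y ≠ 0)
    rw [diagBlock, hk, crossKernel]
    push_cast
    field_simp
    ring
  have pi := (tp.integrableOn_div_add hy).const_mul (tricomiQ z w x)
  have qi := (tq.integrableOn_div_add hy).const_mul (tricomiP z w x)
  have e2 := integral_add iN (qi.sub pi)
  simp only [Pi.sub_apply] at e2
  rw [e, integral_const_mul, e2, integral_sub qi pi, integral_const_mul, integral_const_mul, Fy,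
    crossBlock, crossKernel]
  push_cast
  linear_combination s * weight a x * weight (-a) y / ((x : ℂ) + y) * (m⁻¹ *
    (hN + tricomiP z w x * Gy) - (tricomiP z w x * tricomiP (-z) (-w) y +
      z * w * (tricomiQ z w x * tricomiQ (-z) (-w) y) - 1) * hmi)

end CoreParams

/-! ### Schur's test and integral operators on L² of the half-line. -/

section Schur

variable {α : Type*} [MeasurableSpace α] {μ : Measure α}

/-- Cauchy–Schwarz for the splitting κf = (κρ)^{1/2} · (κ/ρ)^{1/2} f. -/
theorem lintegral_mul_sq_le {κ ρ f : α → ℝ≥0∞} (hκ : AEMeasurable κ μ) (hρ : AEMeasurable ρ μ)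
    (hρ0 : ∀ᵐ y ∂μ, ρ y ≠ 0 ∧ ρ y ≠ ⊤) (hf : AEMeasurable f μ) :
    (∫⁻ y, κ y * f y ∂μ) ^ 2 ≤ (∫⁻ y, κ y * ρ y ∂μ) * ∫⁻ y, κ y * ((ρ y)⁻¹ * f y ^ 2) ∂μ := by
  have hsq : ∀ X : ℝ≥0∞, (X ^ (1 / 2 : ℝ)) ^ 2 = X := fun X => by
    rw [← ENNReal.rpow_natCast, ← ENNReal.rpow_mul]; norm_num
  have key := ENNReal.lintegral_mul_le_Lp_mul_Lq μ (p := 2) (q := 2)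
    (Real.HolderConjugate.two_two) (f := fun y => (κ y * ρ y) ^ (1 / 2 : ℝ))
    (g := fun y => (κ y * (ρ y)⁻¹) ^ (1 / 2 : ℝ) * f y) ((hκ.mul hρ).pow_const _)
    (((hκ.mul hρ.inv).pow_const _).mul hf)
  have e1 : ∫⁻ y, ((fun y => (κ y * ρ y) ^ (1 / 2 : ℝ)) *
      fun y => (κ y * (ρ y)⁻¹) ^ (1 / 2 : ℝ) * f y) y ∂μ = ∫⁻ y, κ y * f y ∂μ := by
    refine lintegral_congr_ae ?_
    filter_upwards [hρ0] with y hy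
    simp only [Pi.mul_apply]
    rw [← mul_assoc, ← ENNReal.mul_rpow_of_nonneg _ _ (by norm_num : (0 : ℝ) ≤ 1 / 2),
      show κ y * ρ y * (κ y * (ρ y)⁻¹) = κ y ^ 2 * (ρ y * (ρ y)⁻¹) by ring,
      ENNReal.mul_inv_cancel hy.1 hy.2, mul_one, ← ENNReal.rpow_natCast, ← ENNReal.rpow_mul]
    norm_num
  rw [e1] at key
  refine (pow_le_pow_left₀ zero_le key 2).trans_eq ?_
  rw [mul_pow, hsq, hsq]
  simp only [ENNReal.rpow_two, mul_pow, hsq, mul_assoc]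

/-- The row bound handles the first Cauchy–Schwarz factor; after Tonelli the column bound handles
the second. -/
theorem lintegral_schur [SFinite μ] {κ : α → α → ℝ≥0∞} (hκ : Measurable (Function.uncurry κ)) {ρ : α → ℝ≥0∞}
    (hρ : Measurable ρ) (hρ0 : ∀ᵐ y ∂μ, ρ y ≠ 0 ∧ ρ y ≠ ⊤) {C : ℝ≥0∞}
    (hrow : ∀ᵐ x ∂μ, ∫⁻ y, κ x y * ρ y ∂μ ≤ C * ρ x)
    (hcol : ∀ᵐ y ∂μ, ∫⁻ x, κ x y * ρ x ∂μ ≤ C * ρ y) {f : α → ℝ≥0∞} (hf : AEMeasurable f μ) :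
    ∫⁻ x, (∫⁻ y, κ x y * f y ∂μ) ^ 2 ∂μ ≤ C ^ 2 * ∫⁻ y, f y ^ 2 ∂μ := by
  have hκx : ∀ x, Measurable (κ x) := fun x => hκ.comp measurable_prodMk_left
  have hm : AEMeasurable (Function.uncurry fun x y => ρ x * (κ x y * ((ρ y)⁻¹ * f y ^ 2)))
      (μ.prod μ) :=
    (hρ.comp measurable_fst).aemeasurable.mul (hκ.aemeasurable.mul
      ((hρ.inv.comp measurable_snd).aemeasurable.mul ((hf.comp_snd).pow_const 2)))
  calc ∫⁻ x, (∫⁻ y, κ x y * f y ∂μ) ^ 2 ∂μ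
      ≤ ∫⁻ x, C * ∫⁻ y, ρ x * (κ x y * ((ρ y)⁻¹ * f y ^ 2)) ∂μ ∂μ := by
        refine lintegral_mono_ae ?_
        filter_upwards [hrow, hρ0] with x hx hx0
        refine (lintegral_mul_sq_le (hκx x).aemeasurable hρ.aemeasurable hρ0 hf).trans ?_
        rw [lintegral_const_mul' _ _ hx0.2, ← mul_assoc]
        gcongr
    _ = C * ∫⁻ x, ∫⁻ y, ρ x * (κ x y * ((ρ y)⁻¹ * f y ^ 2)) ∂μ ∂μ :=
        lintegral_const_mul'' _ hm.lintegral_prod_right'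
    _ = C * ∫⁻ y, ∫⁻ x, ρ x * (κ x y * ((ρ y)⁻¹ * f y ^ 2)) ∂μ ∂μ := by
        rw [lintegral_lintegral_swap hm]
    _ ≤ C * ∫⁻ y, C * f y ^ 2 ∂μ := by
        gcongr C * ?_
        refine lintegral_mono_ae ?_
        filter_upwards [hcol, hρ0] with y hy hy0
        have e : ∀ x, ρ x * (κ x y * ((ρ y)⁻¹ * f y ^ 2)) =
            (κ x y * ρ x) * ((ρ y)⁻¹ * f y ^ 2) := fun x => by ring
        simp only [e]
        have hmy : Measurable fun x => κ x y * ρ x := (hκ.comp measurable_prodMk_right).mul hρ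
        rw [lintegral_mul_const _ hmy]
        calc _ ≤ C * ρ y * ((ρ y)⁻¹ * f y ^ 2) := by gcongr
          _ = C * (ρ y * (ρ y)⁻¹) * f y ^ 2 := by ring
          _ = _ := by rw [ENNReal.mul_inv_cancel hy0.1 hy0.2, mul_one]
    _ = _ := by rw [lintegral_const_mul'' _ (hf.pow_const 2)]; ring

end Schur

/-- A measurable real kernel on the half-line satisfying Schur's test with weight `x ^ (-1/2)`. -/
structure IsSchurKernel (k : ℝ → ℝ → ℝ) : Prop where
  measurable : Measurable (Function.uncurry k)
  bound : ∃ C : ℝ≥0,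
    (∀ᵐ x ∂halfLine, ∫⁻ y, ‖k x y‖ₑ * ENNReal.ofReal (y ^ (-(1 / 2) : ℝ)) ∂halfLine ≤
      C * ENNReal.ofReal (x ^ (-(1 / 2) : ℝ))) ∧
    (∀ᵐ y ∂halfLine, ∫⁻ x, ‖k x y‖ₑ * ENNReal.ofReal (x ^ (-(1 / 2) : ℝ)) ∂halfLine ≤
      C * ENNReal.ofReal (y ^ (-(1 / 2) : ℝ)))

theorem memLp_two_iff {f : ℝ → ℂ} (hf : AEStronglyMeasurable f halfLine) :
    MemLp f 2 halfLine ↔ ∫⁻ x, ‖f x‖ₑ ^ 2 ∂halfLine < ⊤ := by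
  rw [MemLp, and_iff_right hf, eLpNorm_lt_top_iff_lintegral_rpow_enorm_lt_top two_ne_zero
    ENNReal.ofNat_ne_top]
  simp

namespace IsSchurKernel

variable {k : ℝ → ℝ → ℝ}

theorem swap (h : IsSchurKernel k) : IsSchurKernel fun x y => k y x :=
  ⟨h.measurable.comp measurable_swap, by
    obtain ⟨C, h1, h2⟩ := h.bound
    exact ⟨C, h2, h1⟩⟩

theorem exists_lintegral_le (h : IsSchurKernel k) : ∃ C : ℝ≥0, ∀ f : ℝ → ℝ≥0∞,
    AEMeasurable f halfLine → ∫⁻ x, (∫⁻ y, ‖k x y‖ₑ * f y ∂halfLine) ^ 2 ∂halfLine ≤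
      (C : ℝ≥0∞) ^ 2 * ∫⁻ y, f y ^ 2 ∂halfLine := by
  obtain ⟨C, h1, h2⟩ := h.bound
  refine ⟨C, fun f hf => lintegral_schur (κ := fun x y => ‖k x y‖ₑ) h.measurable.enorm
    (ρ := fun y => ENNReal.ofReal (y ^ (-(1 / 2) : ℝ))) (by fun_prop) ?_ h1 h2 hf⟩
  filter_upwards [ae_restrict_mem measurableSet_Ioi] with y hy
  have hy : 0 < y := hy
  exact ⟨(ENNReal.ofReal_pos.2 (by positivity)).ne', ENNReal.ofReal_ne_top⟩

theorem aestronglyMeasurable_mul (h : IsSchurKernel k) {f : ℝ → ℂ}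
    (hf : AEStronglyMeasurable f halfLine) :
    AEStronglyMeasurable (fun p : ℝ × ℝ => (k p.1 p.2 : ℂ) * f p.2) (halfLine.prod halfLine) :=
  (Complex.measurable_ofReal.comp h.measurable).aestronglyMeasurable.mul hf.comp_snd

theorem enorm_ofReal_mul (k : ℝ) (c : ℂ) : ‖(k : ℂ) * c‖ₑ = ‖k‖ₑ * ‖c‖ₑ := by
  rw [enorm_mul]
  congr 1
  simp [enorm_eq_nnnorm]

theorem lintegral_enorm_lt_top (h : IsSchurKernel k) {f : ℝ → ℂ} (hf : MemLp f 2 halfLine) :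
    ∫⁻ x, (∫⁻ y, ‖k x y‖ₑ * ‖f y‖ₑ ∂halfLine) ^ 2 ∂halfLine < ⊤ := by
  obtain ⟨C, hC⟩ := h.exists_lintegral_le
  refine (hC _ hf.1.enorm).trans_lt (ENNReal.mul_lt_top (by finiteness) ?_)
  exact (memLp_two_iff hf.1).1 hf

theorem ae_integrable (h : IsSchurKernel k) {f : ℝ → ℂ} (hf : MemLp f 2 halfLine) :
    ∀ᵐ x ∂halfLine, Integrable (fun y => (k x y : ℂ) * f y) halfLine := by
  have hm := h.aestronglyMeasurable_mul hf.1
  have hm2 : AEMeasurable (fun x => (∫⁻ y, ‖k x y‖ₑ * ‖f y‖ₑ ∂halfLine) ^ 2) halfLine := by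
    refine AEMeasurable.pow_const ?_ 2
    have := hm.enorm.lintegral_prod_right'
    simpa only [enorm_ofReal_mul] using this
  filter_upwards [ae_lt_top' hm2 (h.lintegral_enorm_lt_top hf).ne] with x hx
  refine ⟨((Complex.measurable_ofReal.comp
    (h.measurable.comp measurable_prodMk_left)).aestronglyMeasurable).mul hf.1, ?_⟩
  rw [HasFiniteIntegral]
  simp only [enorm_ofReal_mul]
  exact (ENNReal.pow_lt_top_iff.1 hx).resolve_right (by norm_num)

theorem memLp_integral (h : IsSchurKernel k) {f : ℝ → ℂ} (hf : MemLp f 2 halfLine) :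
    MemLp (fun x => ∫ y, (k x y : ℂ) * f y ∂halfLine) 2 halfLine := by
  rw [memLp_two_iff (h.aestronglyMeasurable_mul hf.1).integral_prod_right']
  refine lt_of_le_of_lt (lintegral_mono fun x => ?_) (h.lintegral_enorm_lt_top hf)
  refine pow_le_pow_left₀ zero_le ((enorm_integral_le_lintegral_enorm _).trans_eq ?_) 2
  simp only [enorm_ofReal_mul]

/-- The bounded operator with a Schur kernel. -/
theorem exists_operator (h : IsSchurKernel k) :
    ∃ T : Lp ℂ 2 halfLine →L[ℂ] Lp ℂ 2 halfLine, ∀ f : Lp ℂ 2 halfLine,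
      T f =ᵐ[halfLine] fun x => ∫ y, (k x y : ℂ) * f y ∂halfLine := by
  obtain ⟨C, hC⟩ := h.exists_lintegral_le
  let T₀ : Lp ℂ 2 halfLine →ₗ[ℂ] Lp ℂ 2 halfLine :=
    { toFun := fun f => (h.memLp_integral (Lp.memLp f)).toLp _
      map_add' := fun f g => by
        refine Lp.ext ?_
        filter_upwards [MemLp.coeFn_toLp (h.memLp_integral (Lp.memLp (f + g))),
          MemLp.coeFn_toLp (h.memLp_integral (Lp.memLp f)),
          MemLp.coeFn_toLp (h.memLp_integral (Lp.memLp g)),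
          Lp.coeFn_add ((h.memLp_integral (Lp.memLp f)).toLp _)
            ((h.memLp_integral (Lp.memLp g)).toLp _),
          h.ae_integrable (Lp.memLp f), h.ae_integrable (Lp.memLp g)] with x h1 h2 h3 h4 h5 h6
        rw [h1, h4, Pi.add_apply, h2, h3, ← integral_add h5 h6]
        refine integral_congr_ae ?_
        filter_upwards [Lp.coeFn_add f g] with y hy
        rw [hy, Pi.add_apply, mul_add]
      map_smul' := fun c f => by
        refine Lp.ext ?_
        filter_upwards [MemLp.coeFn_toLp (h.memLp_integral (Lp.memLp (c • f))),
          MemLp.coeFn_toLp (h.memLp_integral (Lp.memLp f)),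
          Lp.coeFn_smul c ((h.memLp_integral (Lp.memLp f)).toLp _)] with x h1 h2 h4
        rw [h1, RingHom.id_apply, h4, Pi.smul_apply, h2, smul_eq_mul, ← integral_const_mul]
        refine integral_congr_ae ?_
        filter_upwards [Lp.coeFn_smul c f] with y hy
        rw [hy, Pi.smul_apply, smul_eq_mul]
        ring }
  have hT₀ : ∀ f, T₀ f = (h.memLp_integral (Lp.memLp f)).toLp _ := fun f => rfl
  refine ⟨T₀.mkContinuous C fun f => ?_, fun f => ?_⟩
  · rw [hT₀, Lp.norm_toLp, Lp.norm_def, ← ENNReal.coe_toReal C, ← ENNReal.toReal_mul]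
    refine ENNReal.toReal_mono (ENNReal.mul_ne_top ENNReal.coe_ne_top (Lp.eLpNorm_ne_top f)) ?_
    rw [eLpNorm_eq_lintegral_rpow_enorm_toReal two_ne_zero ENNReal.ofNat_ne_top,
      eLpNorm_eq_lintegral_rpow_enorm_toReal two_ne_zero ENNReal.ofNat_ne_top]
    simp only [ENNReal.toReal_ofNat, ENNReal.rpow_two]
    have e : (C : ℝ≥0∞) = ((C : ℝ≥0∞) ^ 2) ^ (1 / 2 : ℝ) := by
      rw [← ENNReal.rpow_natCast, ← ENNReal.rpow_mul]; norm_num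
    rw [e, ← ENNReal.mul_rpow_of_nonneg _ _ (by norm_num : (0 : ℝ) ≤ 1 / 2)]
    refine ENNReal.rpow_le_rpow ?_ (by norm_num)
    refine le_trans (lintegral_mono fun x => ?_) (hC _ (Lp.memLp f).1.enorm)
    refine pow_le_pow_left₀ zero_le ((enorm_integral_le_lintegral_enorm _).trans_eq ?_) 2
    simp only [enorm_ofReal_mul]
  · exact MemLp.coeFn_toLp (h.memLp_integral (Lp.memLp f))

/-- Transposition of a Schur kernel under the integral pairing. -/
theorem integral_integral_mul (h : IsSchurKernel k) {f g : ℝ → ℂ} (hf : MemLp f 2 halfLine)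
    (hg : MemLp g 2 halfLine) :
    ∫ x, g x * ∫ y, (k x y : ℂ) * f y ∂halfLine ∂halfLine =
      ∫ y, f y * ∫ x, (k x y : ℂ) * g x ∂halfLine ∂halfLine := by
  have hm : AEStronglyMeasurable (Function.uncurry fun x y => g x * ((k x y : ℂ) * f y))
      (halfLine.prod halfLine) := hg.1.comp_fst.mul (h.aestronglyMeasurable_mul hf.1)
  have hint : Integrable (Function.uncurry fun x y => g x * ((k x y : ℂ) * f y))
      (halfLine.prod halfLine) := by
    refine ⟨hm, ?_⟩
    rw [HasFiniteIntegral, lintegral_prod _ hm.enorm]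
    have e : ∀ x, ∫⁻ y, ‖Function.uncurry (fun x y => g x * ((k x y : ℂ) * f y)) (x, y)‖ₑ ∂halfLine =
        ‖g x‖ₑ * ∫⁻ y, ‖k x y‖ₑ * ‖f y‖ₑ ∂halfLine := fun x => by
      simp only [Function.uncurry, enorm_mul (g x), enorm_ofReal_mul]
      rw [lintegral_const_mul' _ _ enorm_ne_top]
    simp only [e]
    have hm2 : AEMeasurable (fun x => ∫⁻ y, ‖k x y‖ₑ * ‖f y‖ₑ ∂halfLine) halfLine := by
      have := (h.aestronglyMeasurable_mul hf.1).enorm.lintegral_prod_right'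
      simpa only [enorm_ofReal_mul] using this
    refine lt_of_le_of_lt (ENNReal.lintegral_mul_le_Lp_mul_Lq halfLine
      Real.HolderConjugate.two_two hg.1.enorm hm2) (ENNReal.mul_lt_top ?_ ?_)
    · refine ENNReal.rpow_lt_top_of_nonneg (by norm_num) ?_
      simp only [ENNReal.rpow_two]
      exact ((memLp_two_iff hg.1).1 hg).ne
    · refine ENNReal.rpow_lt_top_of_nonneg (by norm_num) ?_
      simp only [ENNReal.rpow_two]
      exact (h.lintegral_enorm_lt_top hf).ne
  have := integral_integral_swap hint
  simp only [integral_const_mul] at this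
  rw [this]
  congr 1 with y
  rw [← integral_const_mul]
  congr 1 with x
  ring

end IsSchurKernel

theorem measurable_weight (a : ℝ) : Measurable (weight a) := by
  unfold weight
  fun_prop

/-- Dropping the exponentials leaves a kernel homogeneous of degree -1, and y = xv separates the
variables. The integral over v converges at 0 because a < 1/2 and at infinity because a > -1/2. -/
theorem lintegral_crossKernel_le {a s : ℝ} (ha : |a| < 1 / 2) {x : ℝ} (hx : 0 < x) :
    ∫⁻ y, ‖crossKernel a s x y‖ₑ * ENNReal.ofReal (y ^ (-(1 / 2) : ℝ)) ∂halfLine ≤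
      ENNReal.ofReal (|s| * ∫ v in Set.Ioi 0, v ^ (-a - 1 / 2) * (1 + v) ^ (-1 : ℝ)) *
        ENNReal.ofReal (x ^ (-(1 / 2) : ℝ)) := by
  obtain ⟨ha1, ha2⟩ := abs_lt.1 ha
  set φ : ℝ → ℝ := fun v => v ^ (-a - 1 / 2) * (1 + v) ^ (-1 : ℝ) with hφ
  have iφ : IntegrableOn φ (Set.Ioi 0) :=
    integrableOn_rpow_mul_one_add_rpow (by linarith) (by linarith)
  have iφx : IntegrableOn (fun y => φ (x⁻¹ * y)) (Set.Ioi 0) := by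
    rw [integrableOn_Ioi_comp_mul_left_iff φ 0 (inv_pos.2 hx), mul_zero]
    exact iφ
  have hle : ∀ y ∈ Set.Ioi (0 : ℝ), ‖crossKernel a s x y‖ₑ * ENNReal.ofReal (y ^ (-(1 / 2) : ℝ)) ≤
      ENNReal.ofReal (|s| * (x ^ (-(1 / 2) : ℝ) * x⁻¹) * φ (x⁻¹ * y)) := by
    intro y hy
    have hy : 0 < y := hy
    rw [← ofReal_norm, ← ENNReal.ofReal_mul (norm_nonneg _)]
    refine ENNReal.ofReal_le_ofReal ?_
    have wa := weight_pos a hx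
    have wb := weight_pos (-a) hy
    rw [crossKernel, norm_mul, Real.norm_eq_abs s, Real.norm_of_nonneg (by positivity)]
    have e : x ^ (-(1 / 2) : ℝ) * x⁻¹ * φ (x⁻¹ * y) =
        x ^ a * y ^ (-a) / (x + y) * y ^ (-(1 / 2) : ℝ) := by
      simp only [hφ]
      rw [Real.mul_rpow (by positivity) hy.le, Real.inv_rpow hx.le, ← Real.rpow_neg hx.le,
        Real.rpow_neg_one, show -(-a - 1 / 2) = a + 1 / 2 by ring, Real.rpow_add hx,
        show (-a - 1 / 2) = -a + -(1 / 2) by ring, Real.rpow_add hy, Real.rpow_neg hx.le (1 / 2)]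
      have : x ^ (1 / 2 : ℝ) ≠ 0 := by positivity
      field_simp
    rw [mul_assoc |s|, mul_assoc |s|, e]
    have w1 : weight a x ≤ x ^ a :=
      mul_le_of_le_one_right (by positivity) (Real.exp_le_one_iff.2 (by linarith))
    have w2 : weight (-a) y ≤ y ^ (-a) :=
      mul_le_of_le_one_right (by positivity) (Real.exp_le_one_iff.2 (by linarith))
    gcongr
  calc _ ≤ ∫⁻ y in Set.Ioi 0, ENNReal.ofReal (|s| * (x ^ (-(1 / 2) : ℝ) * x⁻¹) * φ (x⁻¹ * y)) :=
        setLIntegral_mono' measurableSet_Ioi hle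
    _ = ENNReal.ofReal (∫ y in Set.Ioi 0, |s| * (x ^ (-(1 / 2) : ℝ) * x⁻¹) * φ (x⁻¹ * y)) := by
        refine (ofReal_integral_eq_lintegral_ofReal (iφx.const_mul _) ?_).symm
        filter_upwards [ae_restrict_mem measurableSet_Ioi] with y hy
        have hy : 0 < y := hy
        simp only [hφ, Pi.zero_apply]
        positivity
    _ = _ := by
        rw [integral_const_mul, integral_comp_mul_left_Ioi φ 0 (inv_pos.2 hx), mul_zero, inv_inv,
          smul_eq_mul, ← ENNReal.ofReal_mul]
        · congr 1
          field_simp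
        · refine mul_nonneg (abs_nonneg _) (setIntegral_nonneg measurableSet_Ioi fun v hv => ?_)
          have hv : 0 < v := hv
          positivity

theorem crossKernel_neg (a s x y : ℝ) : crossKernel (-a) s x y = crossKernel a s y x := by
  rw [crossKernel, crossKernel, neg_neg, add_comm x y, mul_comm (weight (-a) x)]

theorem isSchurKernel_crossKernel {a : ℝ} (s : ℝ) (ha : |a| < 1 / 2) :
    IsSchurKernel (crossKernel a s) := by
  refine ⟨?_, ?_⟩
  · have h1 : Measurable fun p : ℝ × ℝ => weight a p.1 := (measurable_weight a).comp measurable_fst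
    have h2 : Measurable fun p : ℝ × ℝ => weight (-a) p.2 :=
      (measurable_weight (-a)).comp measurable_snd
    exact ((h1.mul h2).div (measurable_fst.add measurable_snd)).const_mul s
  · set c : ℝ → ℝ≥0 := fun a =>
      (|s| * ∫ v in Set.Ioi 0, v ^ (-a - 1 / 2) * (1 + v) ^ (-1 : ℝ)).toNNReal
    -- Transposing the kernel replaces a by -a, so columns need the constant for -a.
    refine ⟨max (c a) (c (-a)), ?_, ?_⟩
    · filter_upwards [ae_restrict_mem measurableSet_Ioi] with x hx
      refine (lintegral_crossKernel_le ha hx).trans ?_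
      gcongr
      exact ENNReal.coe_le_coe.2 (le_max_left (c a) (c (-a)))
    · filter_upwards [ae_restrict_mem measurableSet_Ioi] with y hy
      have := lintegral_crossKernel_le (a := -a) (s := s) (by rwa [abs_neg]) hy
      simp only [crossKernel_neg] at this
      refine this.trans ?_
      gcongr
      exact ENNReal.coe_le_coe.2 (le_max_right (c a) (c (-a)))

/-! ### Skew-adjointness and invertibility. -/

/-- The element -ib is self-adjoint, so i is not in its spectrum; and i - (-ib) = i(1+b). -/
theorem isUnit_one_add_of_star_eq_neg {A : Type*} [CStarAlgebra A] {b : A} (h : star b = -b) :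
    IsUnit (1 + b) := by
  have hsa : IsSelfAdjoint (-(Complex.I • b)) := by
    rw [IsSelfAdjoint, star_neg, star_smul, h]
    simp
  by_contra hu
  have hI : Complex.I ∈ spectrum ℂ (-(Complex.I • b)) := by
    rw [spectrum.mem_iff]
    intro hunit
    refine hu ?_
    have e : algebraMap ℂ A Complex.I - -(Complex.I • b) =
        Units.mk0 Complex.I Complex.I_ne_zero • (1 + b) := by
      rw [Algebra.algebraMap_eq_smul_one, sub_neg_eq_add, ← smul_add]
      rfl
    rwa [e, isUnit_smul_iff] at hunit
  have := hsa.mem_spectrum_eq_re hI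
  simp at this

theorem inner_eq_integral_conj (f g : Lp ℂ 2 halfLine) :
    inner ℂ f g = ∫ x, g x * starRingEnd ℂ (f x) ∂halfLine := by
  rw [L2.inner_def]
  rfl

/-- The kernel is real, so conjugation passes through it and the adjoint has the transposed kernel.
-/
theorem IsSchurKernel.inner_eq {k : ℝ → ℝ → ℝ} (h : IsSchurKernel k)
    {T T' : Lp ℂ 2 halfLine →L[ℂ] Lp ℂ 2 halfLine}
    (hT : ∀ f, T f =ᵐ[halfLine] fun x => ∫ y, (k x y : ℂ) * f y ∂halfLine)
    (hT' : ∀ f, T' f =ᵐ[halfLine] fun x => ∫ y, (k y x : ℂ) * f y ∂halfLine)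
    (f g : Lp ℂ 2 halfLine) : inner ℂ (T f) g = inner ℂ f (T' g) := by
  rw [inner_eq_integral_conj, inner_eq_integral_conj]
  have hf : MemLp (fun x => starRingEnd ℂ (f x)) 2 halfLine := (Lp.memLp f).star
  have key := h.integral_integral_mul hf (Lp.memLp g)
  calc _ = ∫ x, g x * ∫ y, (k x y : ℂ) * starRingEnd ℂ (f y) ∂halfLine ∂halfLine := by
        refine integral_congr_ae ?_
        filter_upwards [hT f] with x hx
        rw [hx, ← integral_conj]
        simp only [map_mul, Complex.conj_ofReal]
    _ = _ := by
        rw [key]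
        refine integral_congr_ae ?_
        filter_upwards [hT' g] with x hx
        rw [hx, mul_comm]

/-! ### Identification of the matrix Whittaker kernel with the Tricomi blocks. -/

/-- The choice made in `whittakerW` is pinned down on the half-line by uniqueness; the factor
x^{-1/2} lowers the weight index from a + 1/2 to a. -/
theorem eq_tricomi_of_isWhittakerW {κ a : ℝ} {μ : ℂ} {f : ℝ → ℂ}
    (h : IsWhittakerW (κ : ℂ) μ fun x => weight (a + 1 / 2) x * f x) {x : ℝ} (hx : 0 < x) :
    whittakerW κ μ x / (√x : ℝ) = weight a x * f x := by
  rw [h.eqOn_whittakerW (Set.mem_Ioi.2 hx)]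
  beta_reduce
  rw [← sqrt_mul_weight a hx]
  have : ((√x : ℝ) : ℂ) ≠ 0 := by exact_mod_cast (Real.sqrt_pos.2 hx).ne'
  push_cast
  field_simp

namespace CoreParams

variable {z w : ℂ} {a η s : ℝ}

theorem aParam_eq (h : CoreParams z w a η) : aParam z w = a := by
  rw [aParam, h.sum_eq]
  simp

theorem APlus_eq (h : CoreParams z w a η) {x : ℝ} (hx : 0 < x) :
    APlus z w x = weight a x * tricomiP z w x := by
  have := eq_tricomi_of_isWhittakerW (h.whittakerSystem.isWhittakerW_p h.whittakerPair.tendsto_p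
    h.mul_eq_sq_sub_sq) hx
  rw [APlus, h.aParam_eq, muParam, ← this]
  push_cast
  rfl

theorem BPlus_eq (h : CoreParams z w a η) {x : ℝ} (hx : 0 < x) :
    BPlus z w x = weight a x * tricomiQ z w x := by
  have := eq_tricomi_of_isWhittakerW (h.whittakerSystem.isWhittakerW_q h.whittakerPair.tendsto_q
    h.mul_eq_sq_sub_sq) hx
  rw [BPlus, h.aParam_eq, muParam, ← this]
  push_cast
  rfl

theorem AMinus_eq (h : CoreParams z w a η) {x : ℝ} (hx : 0 < x) :
    AMinus z w x = weight (-a) x * tricomiP (-z) (-w) x := by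
  have := eq_tricomi_of_isWhittakerW (h.whittakerPair_neg.isWhittakerW_p
    h.whittakerPair_neg.tendsto_p (μ := (z - w) / 2)
    (by rw [h.mul_eq_sq_sub_sq]; push_cast; ring)) hx
  rw [AMinus, h.aParam_eq, muParam, ← this]
  push_cast
  rfl

theorem BMinus_eq (h : CoreParams z w a η) {x : ℝ} (hx : 0 < x) :
    BMinus z w x = weight (-a) x * tricomiQ (-z) (-w) x := by
  have := eq_tricomi_of_isWhittakerW (h.whittakerPair_neg.isWhittakerW_q
    h.whittakerPair_neg.tendsto_q (μ := (z - w) / 2)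
    (by rw [h.mul_eq_sq_sub_sq]; push_cast; ring)) hx
  rw [BMinus, h.aParam_eq, muParam, ← this]
  push_cast
  rfl

theorem KPlusPlus_eq (h : CoreParams z w a η) {x y : ℝ} (hx : 0 < x) (hy : 0 < y) :
    KPlusPlus z w x y = diagBlock z w a x y := by
  rw [KPlusPlus, diagBlock, h.APlus_eq hx, h.APlus_eq hy, h.BPlus_eq hx, h.BPlus_eq hy]
  ring

theorem KMinusMinus_eq (h : CoreParams z w a η) {x y : ℝ} (hx : 0 < x) (hy : 0 < y) :
    KMinusMinus z w x y = diagBlock (-z) (-w) (-a) x y := by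
  rw [KMinusMinus, diagBlock, h.AMinus_eq hx, h.AMinus_eq hy, h.BMinus_eq hx, h.BMinus_eq hy]
  ring

theorem KPlusMinus_eq (h : CoreParams z w a η) {x y : ℝ} (hx : 0 < x) (hy : 0 < y) :
    KPlusMinus z w x y = crossBlock z w a (sigmaParam z w / Real.pi) x y := by
  rw [KPlusMinus, crossBlock, h.APlus_eq hx, h.AMinus_eq hy, h.BPlus_eq hx, h.BMinus_eq hy]
  push_cast
  ring

theorem KMinusPlus_eq (h : CoreParams z w a η) {x y : ℝ} (hx : 0 < x) (hy : 0 < y) :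
    KMinusPlus z w x y = -crossBlock (-z) (-w) (-a) (sigmaParam z w / Real.pi) x y := by
  rw [KMinusPlus, crossBlock, h.APlus_eq hy, h.AMinus_eq hx, h.BPlus_eq hy, h.BMinus_eq hx]
  simp only [neg_neg]
  push_cast
  ring

end CoreParams

theorem rpow_div_mul_exp_eq (a s : ℝ) {x y : ℝ} (hx : 0 < x) (hy : 0 < y) :
    s * (x / y) ^ a * (Real.exp (-(x + y) / 2) / (x + y)) = crossKernel a s x y := by
  rw [crossKernel, weight, weight, Real.div_rpow hx.le hy.le, Real.rpow_neg hy.le,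
    show -(x + y) / 2 = -x / 2 + -y / 2 by ring, Real.exp_add]
  ring

/-! ### The transposed pairing, the constants, and the operator L. -/

/-- If `f = (1 + L) g` and the row `(r₀, r₁)` solves the transposed resolvent equation with
right-hand side `(ℓ₀, ℓ₁)`, then the pairings of `r` with `f` and of `ℓ` with `g` agree. -/
theorem IsSchurKernel.pairing_eq {k : ℝ → ℝ → ℝ} (h : IsSchurKernel k)
    {r₀ r₁ f₀ f₁ g₀ g₁ ℓ₀ ℓ₁ : ℝ → ℂ} (hr₀ : MemLp r₀ 2 halfLine) (hr₁ : MemLp r₁ 2 halfLine)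
    (hg₀ : MemLp g₀ 2 halfLine) (hg₁ : MemLp g₁ 2 halfLine)
    (hf₀ : ∀ᵐ x ∂halfLine, f₀ x = g₀ x + ∫ y, (k x y : ℂ) * g₁ y ∂halfLine)
    (hf₁ : ∀ᵐ x ∂halfLine, f₁ x = g₁ x - ∫ y, (k y x : ℂ) * g₀ y ∂halfLine)
    (hℓ₀ : ∀ᵐ y ∂halfLine, r₀ y - ∫ u, (k y u : ℂ) * r₁ u ∂halfLine = ℓ₀ y)
    (hℓ₁ : ∀ᵐ y ∂halfLine, r₁ y + ∫ u, (k u y : ℂ) * r₀ u ∂halfLine = ℓ₁ y) :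
    ∫ x, r₀ x * f₀ x ∂halfLine + ∫ x, r₁ x * f₁ x ∂halfLine =
      ∫ x, ℓ₀ x * g₀ x ∂halfLine + ∫ x, ℓ₁ x * g₁ x ∂halfLine := by
  have i : ∀ {u v : ℝ → ℂ}, MemLp u 2 halfLine → MemLp v 2 halfLine →
      Integrable (fun x => u x * v x) halfLine := fun hu hv => hu.integrable_mul hv
  -- These two transpositions move k from g onto r; the cross terms then agree, with the signs of
  -- the skew block structure.
  have d₁ := h.integral_integral_mul hg₁ hr₀
  have d₂ := h.integral_integral_mul hr₁ hg₀
  have a₀ : ∫ x, r₀ x * f₀ x ∂halfLine = ∫ x, r₀ x * g₀ x ∂halfLine +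
      ∫ x, r₀ x * ∫ y, (k x y : ℂ) * g₁ y ∂halfLine ∂halfLine := by
    rw [← integral_add (i hr₀ hg₀) (i hr₀ (h.memLp_integral hg₁))]
    refine integral_congr_ae ?_
    filter_upwards [hf₀] with x hx
    rw [hx, mul_add]
  have a₁ : ∫ x, r₁ x * f₁ x ∂halfLine = ∫ x, r₁ x * g₁ x ∂halfLine -
      ∫ x, r₁ x * ∫ y, (k y x : ℂ) * g₀ y ∂halfLine ∂halfLine := by
    rw [← integral_sub (i hr₁ hg₁) (i hr₁ (h.swap.memLp_integral hg₀))]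
    refine integral_congr_ae ?_
    filter_upwards [hf₁] with x hx
    rw [hx, mul_sub]
  have b₀ : ∫ x, ℓ₀ x * g₀ x ∂halfLine = ∫ x, r₀ x * g₀ x ∂halfLine -
      ∫ x, g₀ x * ∫ y, (k x y : ℂ) * r₁ y ∂halfLine ∂halfLine := by
    rw [← integral_sub (i hr₀ hg₀) (i hg₀ (h.memLp_integral hr₁))]
    refine integral_congr_ae ?_
    filter_upwards [hℓ₀] with x hx
    rw [← hx]
    ring
  have b₁ : ∫ x, ℓ₁ x * g₁ x ∂halfLine = ∫ x, r₁ x * g₁ x ∂halfLine +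
      ∫ x, g₁ x * ∫ y, (k y x : ℂ) * r₀ y ∂halfLine ∂halfLine := by
    rw [← integral_add (i hr₁ hg₁) (i hg₁ (h.swap.memLp_integral hr₀))]
    refine integral_congr_ae ?_
    filter_upwards [hℓ₁] with x hx
    rw [← hx]
    ring
  rw [a₀, a₁, b₀, b₁, d₁, d₂]
  ring

/-- In the conjugate case the product of sines is |sin πz|²; in the real case both sines have the
sign (-1)^m. -/
theorem sigmaParam_sq {z w : ℂ} (h : Admissible z w) :
    ((sigmaParam z w : ℝ) : ℂ) ^ 2 = Complex.sin (Real.pi * z) * Complex.sin (Real.pi * w) := by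
  obtain ⟨c, hc, e⟩ : ∃ c : ℝ, 0 ≤ c ∧
      Complex.sin (Real.pi * z) * Complex.sin (Real.pi * w) = c := by
    rcases h with ⟨rfl, -⟩ | ⟨hz, hw, m, h1, h2, h3, h4⟩
    · refine ⟨Complex.normSq (Complex.sin (Real.pi * z)), Complex.normSq_nonneg _, ?_⟩
      rw [← Complex.mul_conj, ← Complex.sin_conj, map_mul, Complex.conj_ofReal]
    · obtain ⟨x, rfl⟩ : ∃ x : ℝ, z = x := ⟨z.re, Complex.ext rfl hz⟩
      obtain ⟨y, rfl⟩ : ∃ y : ℝ, w = y := ⟨w.re, Complex.ext rfl hw⟩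
      simp only [Complex.ofReal_re] at h1 h2 h3 h4
      refine ⟨Real.sin (Real.pi * x) * Real.sin (Real.pi * y), ?_, by push_cast; rfl⟩
      have hs : ∀ u : ℝ, (m : ℝ) < u → u < m + 1 →
          ∃ r : ℝ, 0 < r ∧ Real.sin (Real.pi * u) = (-1) ^ m * r := by
        intro u hu1 hu2
        refine ⟨Real.sin (Real.pi * (u - m)), Real.sin_pos_of_pos_of_lt_pi
          (mul_pos Real.pi_pos (by linarith)) ?_, ?_⟩
        · nlinarith [Real.pi_pos]
        · rw [← Real.sin_add_int_mul_pi]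
          congr 1
          ring
      obtain ⟨r, hr, er⟩ := hs x h1 h2
      obtain ⟨r', hr', er'⟩ := hs y h3 h4
      rw [er, er', show (-1 : ℝ) ^ m * r * ((-1) ^ m * r') = ((-1 : ℝ) ^ m) ^ 2 * (r * r') by ring]
      positivity
  rw [sigmaParam, e, Complex.ofReal_re, ← Complex.ofReal_pow, Real.sq_sqrt hc]

theorem Admissible.coreParams {z w : ℂ} (h : Admissible z w) (ha : |aParam z w| < 1 / 2) :
    ∃ η, CoreParams z w (aParam z w) η := by
  rcases h with ⟨rfl, hz⟩ | ⟨hz, hw, m, h1, h2, h3, h4⟩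
  · have hz0 : z ≠ 0 := by simpa using hz 0
    have e : aParam z (starRingEnd ℂ z) = z.re := by
      rw [aParam, Complex.add_conj]; simp
    -- Here Re z = a, so any η strictly between 0 and 1/2 works.
    refine ⟨1 / 4, ⟨?_, ha, ?_, by norm_num, hz0, by simpa using hz0⟩⟩
    · rw [e, Complex.add_conj]; push_cast; ring
    · rw [e]; norm_num
  · obtain ⟨x, rfl⟩ : ∃ x : ℝ, z = x := ⟨z.re, Complex.ext rfl hz⟩
    obtain ⟨y, rfl⟩ : ∃ y : ℝ, w = y := ⟨w.re, Complex.ext rfl hw⟩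
    simp only [Complex.ofReal_re] at h1 h2 h3 h4
    have e : aParam (x : ℂ) y = (x + y) / 2 := by
      rw [aParam, ← Complex.ofReal_add]
      norm_cast
    have hne : ∀ u : ℝ, (m : ℝ) < u → u < m + 1 → (u : ℂ) ≠ 0 := by
      intro u hu1 hu2 hu
      have hu0 : u = 0 := by exact_mod_cast hu
      rw [hu0] at hu1 hu2
      have i1 : m < 0 := by exact_mod_cast hu1
      have i2 : 0 < m + 1 := by exact_mod_cast hu2
      omega
    have hlt : |(x - y) / 2| < 1 / 2 := by
      rw [abs_lt]; constructor <;> linarith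
    -- The midpoint between |x-y|/2 = |z-a| and 1/2, which is larger since x and y lie in one unit
    -- interval.
    refine ⟨(|(x - y) / 2| + 1 / 2) / 2, ⟨?_, ha, ?_, by linarith, hne x h1 h2, hne y h3 h4⟩⟩
    · rw [e]; push_cast; ring
    · rw [e, Complex.ofReal_re, show x - (x + y) / 2 = (x - y) / 2 by ring]
      linarith

/-- The reflection formula in the form sin(πz) Γ(1+z) Γ(1-z) = πz, used for z and for w. -/
theorem CoreParams.sigma_sq {z w : ℂ} {a η : ℝ} (h : CoreParams z w a η) (hzw : Admissible z w) :
    ((sigmaParam z w / Real.pi : ℝ) : ℂ) ^ 2 *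
      (Complex.Gamma (1 + z) * Complex.Gamma (1 + w) *
      (Complex.Gamma (1 - z) * Complex.Gamma (1 - w))) = z * w := by
  have hpi : (Real.pi : ℂ) ≠ 0 := by exact_mod_cast Real.pi_ne_zero
  have r : ∀ {z w : ℂ}, CoreParams z w a η → Complex.sin (Real.pi * z) *
      (Complex.Gamma (1 + z) * Complex.Gamma (1 - z)) = Real.pi * z := by
    intro z w h
    have hg : Complex.Gamma z ≠ 0 := by
      intro h0
      have := Complex.Gamma_add_one z h.z_ne
      rw [h0, mul_zero] at this
      exact Complex.Gamma_ne_zero_of_re_pos (s := z + 1) (by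
        rw [Complex.add_re, Complex.one_re]; linarith [h.neg_one_lt_re]) this
    have hg' : Complex.Gamma (1 - z) ≠ 0 := Complex.Gamma_ne_zero_of_re_pos (by
        rw [Complex.sub_re, Complex.one_re]; linarith [h.re_lt_one])
    have e := Complex.Gamma_mul_Gamma_one_sub z
    have hs : Complex.sin (Real.pi * z) ≠ 0 := by
      intro h0
      rw [h0, div_zero] at e
      exact mul_ne_zero hg hg' e
    rw [add_comm 1 z, Complex.Gamma_add_one z h.z_ne, mul_assoc, e]
    field_simp
  have e1 := r h
  have e2 := r h.swap
  push_cast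
  rw [div_pow, sigmaParam_sq hzw, div_mul_eq_mul_div, div_eq_iff (pow_ne_zero 2 hpi)]
  linear_combination Complex.sin (Real.pi * w) * (Complex.Gamma (1 + w) * Complex.Gamma (1 - w)) *
    e1 + Real.pi * z * e2

/-- The skew block operator of a Schur kernel, and invertibility of its perturbation of `1`. -/
theorem IsSchurKernel.exists_skew_operator {k : ℝ → ℝ → ℝ} (h : IsSchurKernel k) :
    ∃ L : TwoL2 →L[ℂ] TwoL2,
      (∀ f, L f 0 =ᵐ[halfLine] fun x => ∫ y, (k x y : ℂ) * f 1 y ∂halfLine) ∧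
      (∀ f, L f 1 =ᵐ[halfLine] fun x => -∫ y, (k y x : ℂ) * f 0 y ∂halfLine) ∧
      IsUnit (1 + L) := by
  obtain ⟨T, hT⟩ := h.exists_operator
  obtain ⟨T', hT'⟩ := h.swap.exists_operator
  let L : TwoL2 →L[ℂ] TwoL2 :=
    (PiLp.continuousLinearEquiv 2 ℂ (fun _ : Fin 2 => Lp ℂ 2 halfLine)).symm.toContinuousLinearMap ∘L
      ContinuousLinearMap.pi ![T ∘L PiLp.proj 2 (fun _ : Fin 2 => Lp ℂ 2 halfLine) 1,
        -(T' ∘L PiLp.proj 2 (fun _ : Fin 2 => Lp ℂ 2 halfLine) 0)]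
  have hL0 : ∀ f, L f 0 = T (f 1) := fun f => rfl
  have hL1 : ∀ f, L f 1 = -T' (f 0) := fun f => rfl
  refine ⟨L, fun f => hT (f 1), fun f => ?_, isUnit_one_add_of_star_eq_neg ?_⟩
  · filter_upwards [Lp.coeFn_neg (T' (f 0)), hT' (f 0)] with x h1 h2
    rw [hL1, h1, Pi.neg_apply, h2]
  · rw [ContinuousLinearMap.star_eq_adjoint]
    refine ((ContinuousLinearMap.eq_adjoint_iff _ _).2 fun f g => ?_).symm
    rw [PiLp.inner_apply, PiLp.inner_apply, Fin.sum_univ_two, Fin.sum_univ_two]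
    have e0 : (-L) f 0 = -T (f 1) := rfl
    have e1 : (-L) f 1 = T' (f 0) := by
      change -(-T' (f 0)) = T' (f 0)
      rw [neg_neg]
    have i1 := h.inner_eq hT hT' (f 1) (g 0)
    have i2 := h.swap.inner_eq hT' hT (f 0) (g 1)
    rw [e0, e1, hL0, hL1, inner_neg_left, inner_neg_right, i1, i2, add_comm]

theorem ae_ne_halfLine (x : ℝ) : ∀ᵐ y ∂halfLine, y ≠ x :=
  ae_restrict_of_ae (by simp [ae_iff])

theorem ae_pos_halfLine : ∀ᵐ y ∂halfLine, 0 < y := ae_restrict_mem measurableSet_Ioi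

end MatrixWhittaker

end

/-! ### Assembly of the theorem. -/

open MatrixWhittaker in
theorem mainTheorem2 (z w : ℂ) (hzw : MatrixWhittaker.Admissible z w)
    (ha : |MatrixWhittaker.aParam z w| < 1 / 2) :
    ∃ K L : MatrixWhittaker.TwoL2 →L[ℂ] MatrixWhittaker.TwoL2,
      MatrixWhittaker.HasMatrixKernel K (MatrixWhittaker.whittakerKernel z w) ∧
      MatrixWhittaker.HasMatrixKernel L (MatrixWhittaker.LKernel z w) ∧
      IsUnit (1 + L) ∧
      K = L * Ring.inverse (1 + L) := by
  obtain ⟨η, h⟩ := hzw.coreParams ha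
  set a := aParam z w with ha_def
  set s := sigmaParam z w / Real.pi with hs_def
  have hk := isSchurKernel_crossKernel s ha
  have hsσ := h.sigma_sq hzw
  rw [← hs_def] at hsσ
  have hsσ' : (s : ℂ) ^ 2 * (Complex.Gamma (1 + -z) * Complex.Gamma (1 + -w) *
      (Complex.Gamma (1 - -z) * Complex.Gamma (1 - -w))) = -z * -w := by
    rw [neg_mul_neg, ← hsσ]
    simp only [sub_neg_eq_add, ← sub_eq_add_neg]
    ring
  obtain ⟨L, hL0, hL1, hu⟩ := hk.exists_skew_operator
  have hk01 : ∀ x y : ℝ, 0 < x → 0 < y → LKernel z w 0 1 x y = (crossKernel a s x y : ℂ) :=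
    fun x y hx hy => congrArg Complex.ofReal (rpow_div_mul_exp_eq a s hx hy)
  have hk10 : ∀ x y : ℝ, 0 < x → 0 < y → LKernel z w 1 0 x y = -(crossKernel a s y x : ℂ) := by
    intro x y hx hy
    rw [← rpow_div_mul_exp_eq a s hy hx, add_comm y x]
    simp only [LKernel, Matrix.of_apply, Matrix.cons_val', Matrix.cons_val_zero, Matrix.cons_val_one,
      Matrix.cons_val_fin_one]
    rw [← Complex.ofReal_neg]
    congr 1
    ring
  refine ⟨L * Ring.inverse (1 + L), L, fun f i => ?_, fun f i => ?_, hu, rfl⟩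
  · set g := Ring.inverse (1 + L) f with hg
    have hfg : f = g + L g := by
      have := congrArg (fun S : TwoL2 →L[ℂ] TwoL2 => S f) (Ring.mul_inverse_cancel _ hu)
      exact this.symm
    have hf0 : ∀ᵐ x ∂halfLine, f 0 x = g 0 x + ∫ y, (crossKernel a s x y : ℂ) * g 1 y ∂halfLine := by
      have e : f 0 = g 0 + L g 0 := congrArg (fun v : TwoL2 => v 0) hfg
      filter_upwards [Lp.coeFn_add (g 0) (L g 0), hL0 g] with x h1 h2
      rw [e, h1, Pi.add_apply, h2]
    have hf1 : ∀ᵐ x ∂halfLine, f 1 x = g 1 x - ∫ y, (crossKernel a s y x : ℂ) * g 0 y ∂halfLine := by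
      have e : f 1 = g 1 + L g 1 := congrArg (fun v : TwoL2 => v 1) hfg
      filter_upwards [Lp.coeFn_add (g 1) (L g 1), hL1 g] with x h1 h2
      rw [e, h1, Pi.add_apply, h2, sub_eq_add_neg]
    have hrow : ∀ (r₀ r₁ ℓ₀ ℓ₁ : ℝ → ℂ), MemLp r₀ 2 halfLine → MemLp r₁ 2 halfLine →
        (∀ᵐ y ∂halfLine, r₀ y - ∫ u, (crossKernel a s y u : ℂ) * r₁ u ∂halfLine = ℓ₀ y) →
        (∀ᵐ y ∂halfLine, r₁ y + ∫ u, (crossKernel a s u y : ℂ) * r₀ u ∂halfLine = ℓ₁ y) →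
        Integrable (fun y => r₀ y * f 0 y) halfLine ∧ Integrable (fun y => r₁ y * f 1 y) halfLine ∧
        ∫ x, r₀ x * f 0 x ∂halfLine + ∫ x, r₁ x * f 1 x ∂halfLine =
          ∫ x, ℓ₀ x * g 0 x ∂halfLine + ∫ x, ℓ₁ x * g 1 x ∂halfLine :=
      fun r₀ r₁ ℓ₀ ℓ₁ h0 h1 e0 e1 => ⟨h0.integrable_mul (Lp.memLp (f 0)),
        h1.integrable_mul (Lp.memLp (f 1)), hk.pairing_eq h0 h1 (Lp.memLp (g 0)) (Lp.memLp (g 1))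
          hf0 hf1 e0 e1⟩
    have hKf : (L * Ring.inverse (1 + L)) f = L g := rfl
    rw [hKf]
    fin_cases i
    · filter_upwards [hL0 g, ae_pos_halfLine] with x hx hx0
      have hpm : KPlusMinus z w x =ᵐ[halfLine] crossBlock z w a s x := by
        filter_upwards [ae_pos_halfLine] with y hy using h.KPlusMinus_eq hx0 hy
      have hpp : KPlusPlus z w x =ᵐ[halfLine] diagBlock z w a x := by
        filter_upwards [ae_pos_halfLine] with y hy using h.KPlusPlus_eq hx0 hy
      have mpm := h.memLp_crossBlock (s := s) hx0
      have eq1 : ∀ᵐ y ∂halfLine, ∫ u, (crossKernel a s y u : ℂ) * crossBlock z w a s x u ∂halfLine =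
          diagBlock z w a x y := by
        filter_upwards [ae_pos_halfLine, ae_ne_halfLine x] with y hy hyx
        exact h.diagBlock_eq_integral hsσ hx0 hy hyx.symm
      -- By the first row equation this row is the image of the cross row under a bounded operator,
      -- so its square integrability needs no analysis near y = x.
      have mpp : MemLp (diagBlock z w a x) 2 halfLine :=
        (memLp_congr_ae eq1).1 (hk.memLp_integral mpm)
      -- The right-hand side (0, k(x,·)) is the first row of L, so the pairing returns (Lg)₀(x).
      obtain ⟨i0, i1, e⟩ := hrow (diagBlock z w a x) (crossBlock z w a s x) 0
        (fun y => crossKernel a s x y) mpp mpm (by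
          filter_upwards [eq1] with y hy
          rw [hy, sub_self, Pi.zero_apply]) (by
          filter_upwards [ae_pos_halfLine] with y hy using h.crossBlock_add_integral hx0 hy)
      have c0 : (fun y => KPlusPlus z w x y * f 0 y) =ᵐ[halfLine]
          fun y => diagBlock z w a x y * f 0 y := by
        filter_upwards [hpp] with y hy
        rw [hy]
      have c1 : (fun y => KPlusMinus z w x y * f 1 y) =ᵐ[halfLine]
          fun y => crossBlock z w a s x y * f 1 y := by
        filter_upwards [hpm] with y hy
        rw [hy]
      refine ⟨Fin.forall_fin_two.2 ⟨i0.congr c0.symm, i1.congr c1.symm⟩, ?_⟩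
      rw [Fin.sum_univ_two]
      change L g 0 x = ∫ y, KPlusPlus z w x y * f 0 y ∂halfLine +
        ∫ y, KPlusMinus z w x y * f 1 y ∂halfLine
      rw [integral_congr_ae c0, integral_congr_ae c1, e, hx]
      simp only [Pi.zero_apply, zero_mul, integral_zero, zero_add]
    · filter_upwards [hL1 g, ae_pos_halfLine] with x hx hx0
      have hmp : KMinusPlus z w x =ᵐ[halfLine] -crossBlock (-z) (-w) (-a) s x := by
        filter_upwards [ae_pos_halfLine] with y hy using h.KMinusPlus_eq hx0 hy
      have hmm : KMinusMinus z w x =ᵐ[halfLine] diagBlock (-z) (-w) (-a) x := by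
        filter_upwards [ae_pos_halfLine] with y hy using h.KMinusMinus_eq hx0 hy
      have mmp := h.neg.memLp_crossBlock (s := s) hx0
      have eq1 : ∀ᵐ y ∂halfLine, ∫ u, (crossKernel a s u y : ℂ) *
          crossBlock (-z) (-w) (-a) s x u ∂halfLine = diagBlock (-z) (-w) (-a) x y := by
        filter_upwards [ae_pos_halfLine, ae_ne_halfLine x] with y hy hyx
        have := h.neg.diagBlock_eq_integral hsσ' hx0 hy hyx.symm
        simpa only [crossKernel_neg] using this
      have mmm : MemLp (diagBlock (-z) (-w) (-a) x) 2 halfLine :=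
        (memLp_congr_ae eq1).1 (hk.swap.memLp_integral mmp)
      -- The second row of L is (-k(·,x), 0); the equations are those of the first row for the
      -- negated parameters, where k becomes its transpose.
      obtain ⟨i0, i1, e⟩ := hrow (-crossBlock (-z) (-w) (-a) s x) (diagBlock (-z) (-w) (-a) x)
        (fun y => -crossKernel a s y x) 0 mmp.neg mmm (by
          filter_upwards [ae_pos_halfLine] with y hy
          have := h.neg.crossBlock_add_integral (s := s) hx0 hy
          simp only [crossKernel_neg] at this
          rw [← this, Pi.neg_apply]
          ring) (by
          filter_upwards [eq1] with y hy
          simp only [Pi.neg_apply, mul_neg, integral_neg, hy, Pi.zero_apply, add_neg_cancel])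
      have c0 : (fun y => KMinusPlus z w x y * f 0 y) =ᵐ[halfLine]
          fun y => (-crossBlock (-z) (-w) (-a) s x) y * f 0 y := by
        filter_upwards [hmp] with y hy
        rw [hy]
      have c1 : (fun y => KMinusMinus z w x y * f 1 y) =ᵐ[halfLine]
          fun y => diagBlock (-z) (-w) (-a) x y * f 1 y := by
        filter_upwards [hmm] with y hy
        rw [hy]
      refine ⟨Fin.forall_fin_two.2 ⟨i0.congr c0.symm, i1.congr c1.symm⟩, ?_⟩
      rw [Fin.sum_univ_two]
      change L g 1 x = ∫ y, KMinusPlus z w x y * f 0 y ∂halfLine +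
        ∫ y, KMinusMinus z w x y * f 1 y ∂halfLine
      rw [integral_congr_ae c0, integral_congr_ae c1, e, hx]
      simp only [Pi.zero_apply, zero_mul, integral_zero, add_zero, neg_mul, integral_neg]
  · fin_cases i
    · filter_upwards [hL0 f, ae_pos_halfLine, hk.ae_integrable (Lp.memLp (f 1))] with x hx hx0 hi
      have c1 : (fun y => LKernel z w 0 1 x y * f 1 y) =ᵐ[halfLine]
          fun y => (crossKernel a s x y : ℂ) * f 1 y := by
        filter_upwards [ae_pos_halfLine] with y hy
        rw [hk01 x y hx0 hy]
      have c0 : (fun y => LKernel z w 0 0 x y * f 0 y) = fun _ => 0 := by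
        funext y
        simp [LKernel]
      refine ⟨Fin.forall_fin_two.2 ⟨?_, hi.congr c1.symm⟩, ?_⟩
      · change Integrable (fun y => LKernel z w 0 0 x y * f 0 y) halfLine
        rw [c0]
        exact integrable_zero _ _ _
      · rw [Fin.sum_univ_two]
        change L f 0 x = ∫ y, LKernel z w 0 0 x y * f 0 y ∂halfLine +
          ∫ y, LKernel z w 0 1 x y * f 1 y ∂halfLine
        rw [c0, integral_zero, zero_add, integral_congr_ae c1, hx]
    · filter_upwards [hL1 f, ae_pos_halfLine, hk.swap.ae_integrable (Lp.memLp (f 0))]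
        with x hx hx0 hi
      have c0 : (fun y => LKernel z w 1 0 x y * f 0 y) =ᵐ[halfLine]
          fun y => -((crossKernel a s y x : ℂ) * f 0 y) := by
        filter_upwards [ae_pos_halfLine] with y hy
        rw [hk10 x y hx0 hy, neg_mul]
      have c1 : (fun y => LKernel z w 1 1 x y * f 1 y) = fun _ => 0 := by
        funext y
        simp [LKernel]
      refine ⟨Fin.forall_fin_two.2 ⟨hi.neg.congr c0.symm, ?_⟩, ?_⟩
      · change Integrable (fun y => LKernel z w 1 1 x y * f 1 y) halfLine
        rw [c1]
        exact integrable_zero _ _ _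
      · rw [Fin.sum_univ_two]
        change L f 1 x = ∫ y, LKernel z w 1 0 x y * f 0 y ∂halfLine +
          ∫ y, LKernel z w 1 1 x y * f 1 y ∂halfLine
        rw [c1, integral_zero, add_zero, integral_congr_ae c0, hx, integral_neg]
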